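/- Let $s\in(\tfrac34,1)$. **Assumptions.** - $M:[0,\infty)\to[0,\infty)$ is continuous and nondecreasing, there is $m_0>0$ with $M(t)\ge m_0$ for all $t\ge 0$, and $\frac{M(t_1)}{t_1}-\frac{M(t_2)}{t_2}\le m_0\bigl(\frac1{t_1}-\frac1{t_2}\bigr)$ for all $t_1\ge t_2>0$. - $V:\mathbb R^3\to\mathbb R$ is continuous with $V_0:=\inf_{\mathbb R^3} V>0$. For some $\delta>0$, $\Omega\subset\mathbb R^3$ is a bounded Lipschitz domain such that $V_0<\min_{\partial\Omega}V$, the set $\Lambda:=\{x\in\Omega: V(x)=V_0\}$ is nonempty, and $\{x\in\mathbb R^3:\operatorname{dist}(x,\Lambda)\le\delta\}\subset\Omega$. - $f:\mathbb R\to\mathbb R$ is continuous and vanishes on $(-\infty,0)$, and with $F(t)=\int_0^t f(\tau)\,d\tau$: - $\lim_{t\to0^+} f(t)/t^3=0$; - there is $q\in(4,\frac{6}{3-2s})$ with $\lim_{t\to\infty} f(t)/t^{q-1}=0$; - there is $\vartheta\in(4,\frac6{3-2s})$ with $0<\vartheta F(t)\le f(t)t$ for all $t>0$; - $t\mapsto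 f(t)/t^3$ is nondecreasing on $(0,\infty)$. **Penalization.** Let $K>2/m_0$ and let $a>0$ satisfy $f(a)=\frac{V_0}{K}a$. Put $\tilde f(t)=f(t)$ for $t\le a$ and $\tilde f(t)=\frac{V_0}{K}t$ for $t>a$. Further put $g(x,t)=\chi_\Omega(x)f(t)+(1-\chi_\Omega(x))\tilde f(t)$, $G(x,t)=\int_0^t g(x,\tau)\,d\tau$ and $\widehat M(t)=\int_0^tM(\tau)\,d\tau$. **The functional.** For $\varepsilon>0$ let $$\mathcal H_\varepsilon=\Bigl\{u\in L^2(\mathbb R^3):\iint_{\mathbb R^6}\frac{|u(x)-u(y)|^2}{|x-y|^{3+2s}}\,dx\,dy<\infty,\ \int_{\mathbb R^3}V(\varepsilon x)u^2\,dx<\infty\Bigr\},$$ with the norm $$\|u\|_\varepsilon^2=\iint_{\mathbb R^6}\frac{|u(x)-u(y)|^2}{|x-y|^{3+2s}}\,dx\,dy+\int_{\mathbb R^3}V(\varepsilon x)u^2\,dx$$ and the corresponding inner product, and let $$\mathcal J_\varepsilon(u)=\tfrac12\widehat M(\|u\|_\varepsilon^2)-\int_{\mathbb R^3}G(\varepsilon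 x,u(x))\,dx,\qquad u\in\mathcal H_\varepsilon .$$ **Claim.** For every $\varepsilon>0$, the functional $\mathcal J_\varepsilon$ is well defined (that is, $x\mapsto G(\varepsilon x,u(x))$ is integrable for every $u\in\mathcal H_\varepsilon$) and of class $C^1$ on $\mathcal H_\varepsilon$, and it satisfies the Palais–Smale condition at every level $d\in\mathbb R$: every sequence $(u_n)$ in $\mathcal H_\varepsilon$ with $\mathcal J_\varepsilon(u_n)\to d$ and $\mathcal J_\varepsilon'(u_n)\to0$ in the dual of $\mathcal H_\varepsilon$ has a subsequence converging in the norm of $\mathcal H_\varepsilon$. -/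

import Mathlib

open MeasureTheory Set Filter Topology
open scoped NNReal ENNReal

noncomputable section

namespace FracKirchhoff

/-- The Euclidean space `ℝ³`. -/
abbrev E3 : Type := EuclideanSpace ℝ (Fin 3)

/-! ### Assumptions on the data -/

/-- Assumptions on the Kirchhoff function `M : [0, ∞) → [0, ∞)` (values at negative arguments
are irrelevant): continuity, lower bound `m₀ > 0`, monotonicity, and
`M(t₁)/t₁ - M(t₂)/t₂ ≤ m₀ (1/t₁ - 1/t₂)` for `t₁ ≥ t₂ > 0`. -/
structure IsKirchhoff (M : ℝ → ℝ) (m₀ : ℝ) : Prop where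
  continuousOn : ContinuousOn M (Ici 0)
  m₀_pos : 0 < m₀
  lower : ∀ t, 0 ≤ t → m₀ ≤ M t
  mono : MonotoneOn M (Ici 0)
  quotient : ∀ t₁ t₂, 0 < t₂ → t₂ ≤ t₁ →
    M t₁ / t₁ - M t₂ / t₂ ≤ m₀ * (1 / t₁ - 1 / t₂)

/-- A continuous potential on `ℝ³` with `V₀ = inf V > 0`. -/
structure Potential where
  V : E3 → ℝ
  continuous_V : Continuous V
  V₀ : ℝ
  V₀_pos : 0 < V₀
  isGLB : IsGLB (range V) V₀

/-- Locally, after an orthogonal change of coordinates, `Ω` is the region strictly above the graph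
of a Lipschitz function of two variables. -/
def HasLipschitzBoundary (Ω : Set E3) : Prop :=
  ∀ p ∈ frontier Ω, ∃ r : ℝ, 0 < r ∧ ∃ (e : E3 ≃ₗᵢ[ℝ] E3) (γ : EuclideanSpace ℝ (Fin 2) → ℝ)
    (L : ℝ≥0), LipschitzWith L γ ∧
      ∀ x ∈ Metric.ball p r, x ∈ Ω ↔ γ !₂[(e x) 0, (e x) 1] < (e x) 2

/-- The set `Λ = {x ∈ Ω : V(x) = V₀}`. -/
def Potential.wellSet (P : Potential) (Ω : Set E3) : Set E3 := {x ∈ Ω | P.V x = P.V₀}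

/-- `Ω` is a bounded Lipschitz domain with `V₀ < min_{∂Ω} V`, `Λ ≠ ∅` and
`Λ_δ = {x : dist(x, Λ) ≤ δ} ⊆ Ω`. -/
structure IsWellDomain (P : Potential) (δ : ℝ) (Ω : Set E3) : Prop where
  isOpen : IsOpen Ω
  isConnected : IsConnected Ω
  isBounded : Bornology.IsBounded Ω
  lipschitz : HasLipschitzBoundary Ω
  boundary : ∀ x ∈ frontier Ω, P.V₀ < P.V x
  nonempty : (P.wellSet Ω).Nonempty
  thickening : {x | Metric.infDist x (P.wellSet Ω) ≤ δ} ⊆ Ω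

/-- Assumptions on the nonlinearity `f`; here `6 / (3 - 2s)` is the critical exponent and
`F(t) = ∫₀ᵗ f`. -/
structure IsNonlinearity (s : ℝ) (f : ℝ → ℝ) : Prop where
  continuous : Continuous f
  zero_of_neg : ∀ t < 0, f t = 0
  at_zero : Tendsto (fun t => f t / t ^ 3) (𝓝[>] 0) (𝓝 0)
  at_top : ∃ q : ℝ, 4 < q ∧ q < 6 / (3 - 2 * s) ∧
    Tendsto (fun t => f t / t ^ (q - 1)) atTop (𝓝 0)
  ambrosettiRabinowitz : ∃ θ : ℝ, 4 < θ ∧ θ < 6 / (3 - 2 * s) ∧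
    ∀ t, 0 < t → 0 < θ * (∫ τ in (0 : ℝ)..t, f τ) ∧ θ * (∫ τ in (0 : ℝ)..t, f τ) ≤ f t * t
  mono : MonotoneOn (fun t => f t / t ^ 3) (Ioi 0)

/-! ### The penalized nonlinearity -/

/-- `f̃(t) = f(t)` for `t ≤ a` and `f̃(t) = (V₀/K) t` for `t > a`. -/
def truncated (f : ℝ → ℝ) (V₀ K a : ℝ) (t : ℝ) : ℝ := if t ≤ a then f t else V₀ / K * t

open Classical in
/-- `g(x,t) = χ_Ω(x) f(t) + (1 - χ_Ω(x)) f̃(t)`. -/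
def penalized (f : ℝ → ℝ) (V₀ K a : ℝ) (Ω : Set E3) (x : E3) (t : ℝ) : ℝ :=
  if x ∈ Ω then f t else truncated f V₀ K a t

/-- `G(x,t) = ∫₀ᵗ g(x,τ) dτ`. -/
def penalizedPrimitive (f : ℝ → ℝ) (V₀ K a : ℝ) (Ω : Set E3) (x : E3) (t : ℝ) : ℝ :=
  ∫ τ in (0 : ℝ)..t, penalized f V₀ K a Ω x τ

/-! ### The fractional Sobolev space `H_ε` -/

/-- `(u(x)-u(y)) (v(x)-v(y)) / |x-y|^{3+2s}` as a function of `(x,y) ∈ ℝ³ × ℝ³`. -/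
def gagliardoIntegrand (s : ℝ) (u v : E3 → ℝ) (p : E3 × E3) : ℝ :=
  (u p.1 - u p.2) * (v p.1 - v p.2) / ‖p.1 - p.2‖ ^ (3 + 2 * s)

/-- `V(εx) u(x) v(x)`. -/
def potentialIntegrand (P : Potential) (ε : ℝ) (u v : E3 → ℝ) (x : E3) : ℝ :=
  P.V (ε • x) * (u x * v x)

lemma Potential.pos (P : Potential) (x : E3) : 0 < P.V x :=
  P.V₀_pos.trans_le (P.isGLB.1 (mem_range_self x))

lemma gagliardo_congr (s : ℝ) {u u' v v' : E3 → ℝ} (hu : u =ᵐ[volume] u')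
    (hv : v =ᵐ[volume] v') :
    gagliardoIntegrand s u v =ᵐ[volume] gagliardoIntegrand s u' v' := by
  have h1 := (Measure.quasiMeasurePreserving_fst (μ := (volume : Measure E3))
    (ν := (volume : Measure E3)))
  have h2 := (Measure.quasiMeasurePreserving_snd (μ := (volume : Measure E3))
    (ν := (volume : Measure E3)))
  filter_upwards [h1.ae hu, h2.ae hu, h1.ae hv, h2.ae hv] with p a b c d
  simp only [gagliardoIntegrand, a, b, c, d]

lemma potential_congr (P : Potential) (ε : ℝ) {u u' v v' : E3 → ℝ} (hu : u =ᵐ[volume] u')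
    (hv : v =ᵐ[volume] v') :
    potentialIntegrand P ε u v =ᵐ[volume] potentialIntegrand P ε u' v' := by
  filter_upwards [hu, hv] with p a b
  simp only [potentialIntegrand, a, b]

lemma gagliardo_aesm (s : ℝ) {u v : E3 → ℝ} (hu : AEStronglyMeasurable u volume)
    (hv : AEStronglyMeasurable v volume) :
    AEStronglyMeasurable (gagliardoIntegrand s u v) (volume : Measure (E3 × E3)) := by
  have h1 := (Measure.quasiMeasurePreserving_fst (μ := (volume : Measure E3))
    (ν := (volume : Measure E3)))
  have h2 := (Measure.quasiMeasurePreserving_snd (μ := (volume : Measure E3))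
    (ν := (volume : Measure E3)))
  have hk : Measurable (fun p : E3 × E3 => (‖p.1 - p.2‖ ^ (3 + 2 * s))⁻¹) := by fun_prop
  exact (((hu.comp_quasiMeasurePreserving h1).sub (hu.comp_quasiMeasurePreserving h2)).mul
    ((hv.comp_quasiMeasurePreserving h1).sub (hv.comp_quasiMeasurePreserving h2))).mul
    hk.aestronglyMeasurable

lemma potential_aesm (P : Potential) (ε : ℝ) {u v : E3 → ℝ}
    (hu : AEStronglyMeasurable u volume) (hv : AEStronglyMeasurable v volume) :
    AEStronglyMeasurable (potentialIntegrand P ε u v) volume := by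
  have hk : Continuous (fun x : E3 => P.V (ε • x)) :=
    P.continuous_V.comp (continuous_const_smul ε)
  exact hk.aestronglyMeasurable.mul (hu.mul hv)

lemma abs_mul_le_sq_add_sq (a b : ℝ) : |a * b| ≤ a * a + b * b := by
  rw [abs_le]; constructor <;> nlinarith [sq_nonneg (a + b), sq_nonneg (a - b)]

lemma gagliardo_mixed (s : ℝ) {u v : E3 → ℝ} (hu : AEStronglyMeasurable u volume)
    (hv : AEStronglyMeasurable v volume)
    (iu : Integrable (gagliardoIntegrand s u u)) (iv : Integrable (gagliardoIntegrand s v v)) :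
    Integrable (gagliardoIntegrand s u v) := by
  refine (iu.add iv).mono' (gagliardo_aesm s hu hv) (Eventually.of_forall fun p => ?_)
  have hk : 0 ≤ ‖p.1 - p.2‖ ^ (3 + 2 * s) := by positivity
  simp only [gagliardoIntegrand, Pi.add_apply, Real.norm_eq_abs, abs_div, abs_of_nonneg hk]
  rw [← add_div]
  exact div_le_div_of_nonneg_right (abs_mul_le_sq_add_sq _ _) hk

lemma potential_mixed (P : Potential) (ε : ℝ) {u v : E3 → ℝ}
    (hu : AEStronglyMeasurable u volume) (hv : AEStronglyMeasurable v volume)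
    (iu : Integrable (potentialIntegrand P ε u u)) (iv : Integrable (potentialIntegrand P ε v v)) :
    Integrable (potentialIntegrand P ε u v) := by
  refine (iu.add iv).mono' (potential_aesm P ε hu hv) (Eventually.of_forall fun x => ?_)
  have hk : 0 ≤ P.V (ε • x) := (P.pos _).le
  simp only [potentialIntegrand, Pi.add_apply, Real.norm_eq_abs, abs_mul (P.V _),
    abs_of_nonneg hk]
  rw [← mul_add]
  exact mul_le_mul_of_nonneg_left (abs_mul_le_sq_add_sq _ _) hk

lemma gagliardo_add_left (s : ℝ) (u u' v : E3 → ℝ) :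
    gagliardoIntegrand s (u + u') v = gagliardoIntegrand s u v + gagliardoIntegrand s u' v := by
  funext p; simp only [gagliardoIntegrand, Pi.add_apply]; ring

lemma gagliardo_smul_left (s c : ℝ) (u v : E3 → ℝ) :
    gagliardoIntegrand s (c • u) v = c • gagliardoIntegrand s u v := by
  funext p; simp only [gagliardoIntegrand, Pi.smul_apply, smul_eq_mul]; ring

lemma gagliardo_comm (s : ℝ) (u v : E3 → ℝ) :
    gagliardoIntegrand s u v = gagliardoIntegrand s v u := by
  funext p; simp only [gagliardoIntegrand]; ring

lemma potential_add_left (P : Potential) (ε : ℝ) (u u' v : E3 → ℝ) :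
    potentialIntegrand P ε (u + u') v
      = potentialIntegrand P ε u v + potentialIntegrand P ε u' v := by
  funext p; simp only [potentialIntegrand, Pi.add_apply]; ring

lemma potential_smul_left (P : Potential) (ε c : ℝ) (u v : E3 → ℝ) :
    potentialIntegrand P ε (c • u) v = c • potentialIntegrand P ε u v := by
  funext p; simp only [potentialIntegrand, Pi.smul_apply, smul_eq_mul]; ring

lemma potential_comm (P : Potential) (ε : ℝ) (u v : E3 → ℝ) :
    potentialIntegrand P ε u v = potentialIntegrand P ε v u := by
  funext p; simp only [potentialIntegrand]; ring

/-- `{u ∈ L²(ℝ³) : ∬ |u(x)-u(y)|²/|x-y|^{3+2s} < ∞, ∫ V(εx) u² < ∞}` as a linear subspace of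
`L²(ℝ³)`. -/
def energySubspace (s : ℝ) (P : Potential) (ε : ℝ) :
    Submodule ℝ (Lp ℝ 2 (volume : Measure E3)) where
  carrier := {u | Integrable (gagliardoIntegrand s u u) (volume : Measure (E3 × E3)) ∧
    Integrable (potentialIntegrand P ε u u) volume}
  zero_mem' := by
    have h0 := Lp.coeFn_zero ℝ 2 (volume : Measure E3)
    refine ⟨(integrable_zero _ _ _).congr ((gagliardo_congr s h0 h0).trans ?_).symm,
      (integrable_zero _ _ _).congr ((potential_congr P ε h0 h0).trans ?_).symm⟩
    · exact Eventually.of_forall fun p => by simp [gagliardoIntegrand]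
    · exact Eventually.of_forall fun p => by simp [potentialIntegrand]
  add_mem' := by
    rintro u v ⟨hu, hu'⟩ ⟨hv, hv'⟩
    have mu := Lp.aestronglyMeasurable u
    have mv := Lp.aestronglyMeasurable v
    have h := Lp.coeFn_add u v
    constructor
    · refine Integrable.congr ?_ (gagliardo_congr s h h).symm
      rw [gagliardo_add_left, gagliardo_comm s u, gagliardo_comm s v, gagliardo_add_left,
        gagliardo_add_left]
      exact (hu.add (gagliardo_mixed s mv mu hv hu)).add
        ((gagliardo_mixed s mu mv hu hv).add hv)
    · refine Integrable.congr ?_ (potential_congr P ε h h).symm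
      rw [potential_add_left, potential_comm P ε u, potential_comm P ε v, potential_add_left,
        potential_add_left]
      exact (hu'.add (potential_mixed P ε mv mu hv' hu')).add
        ((potential_mixed P ε mu mv hu' hv').add hv')
  smul_mem' := by
    rintro c u ⟨hu, hu'⟩
    have h := Lp.coeFn_smul c u
    constructor
    · refine Integrable.congr ?_ (gagliardo_congr s h h).symm
      rw [gagliardo_smul_left, gagliardo_comm, gagliardo_smul_left]
      exact (hu.smul c).smul c
    · refine Integrable.congr ?_ (potential_congr P ε h h).symm
      rw [potential_smul_left, potential_comm, potential_smul_left]
      exact (hu'.smul c).smul c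

/-- The space `H_ε`. It is a separate type so that it carries its own norm `‖·‖_ε` below, not the
`L²` norm. -/
def HSpace (s : ℝ) (P : Potential) (ε : ℝ) : Type := ↥(energySubspace s P ε)

namespace HSpace

variable {s : ℝ} {P : Potential} {ε : ℝ}

instance : AddCommGroup (HSpace s P ε) := inferInstanceAs (AddCommGroup ↥(energySubspace s P ε))

instance : Module ℝ (HSpace s P ε) := inferInstanceAs (Module ℝ ↥(energySubspace s P ε))

/-- The underlying element of `L²(ℝ³)`. -/
def toL2 (u : HSpace s P ε) : Lp ℝ 2 (volume : Measure E3) := Subtype.val u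

/-- A representative of `u`. -/
def toFun (u : HSpace s P ε) : E3 → ℝ := u.toL2

instance : CoeFun (HSpace s P ε) (fun _ => E3 → ℝ) := ⟨toFun⟩

lemma aesm (u : HSpace s P ε) : AEStronglyMeasurable u volume := Lp.aestronglyMeasurable u.toL2

lemma coe_add (u v : HSpace s P ε) : ⇑(u + v) =ᵐ[volume] ⇑u + ⇑v :=
  Lp.coeFn_add u.toL2 v.toL2

lemma coe_smul (c : ℝ) (u : HSpace s P ε) : ⇑(c • u) =ᵐ[volume] c • ⇑u :=
  Lp.coeFn_smul c u.toL2

lemma integrable_gagliardo (u v : HSpace s P ε) :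
    Integrable (gagliardoIntegrand s u v) (volume : Measure (E3 × E3)) :=
  gagliardo_mixed s u.aesm v.aesm u.2.1 v.2.1

lemma integrable_potential (u v : HSpace s P ε) :
    Integrable (potentialIntegrand P ε u v) volume :=
  potential_mixed P ε u.aesm v.aesm u.2.2 v.2.2

/-- `(u,v)_ε = ∬ (u(x)-u(y)) (v(x)-v(y)) / |x-y|^{3+2s} dx dy + ∫ V(εx) u(x) v(x) dx`. -/
def innerε (u v : HSpace s P ε) : ℝ :=
  (∫ p : E3 × E3, gagliardoIntegrand s u v p) + ∫ x : E3, potentialIntegrand P ε u v x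

lemma gagliardo_self_nonneg (u : E3 → ℝ) (p : E3 × E3) : 0 ≤ gagliardoIntegrand s u u p :=
  div_nonneg (mul_self_nonneg _) (by positivity)

lemma potential_self_nonneg (u : E3 → ℝ) (x : E3) : 0 ≤ potentialIntegrand P ε u u x :=
  mul_nonneg (P.pos _).le (mul_self_nonneg _)

/-- `(·,·)_ε` is an inner product on `H_ε`. -/
@[reducible] def core : InnerProductSpace.Core ℝ (HSpace s P ε) where
  inner := innerε
  conj_inner_symm u v := by
    simp only [innerε, conj_trivial, gagliardo_comm s v, potential_comm P ε v]
  re_inner_nonneg u := by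
    simp only [innerε, RCLike.re_to_real]
    exact add_nonneg (integral_nonneg (gagliardo_self_nonneg u))
      (integral_nonneg (potential_self_nonneg u))
  add_left u v w := by
    simp only [innerε]
    rw [integral_congr_ae (gagliardo_congr s (coe_add u v) (EventuallyEq.refl _ _)),
      integral_congr_ae (potential_congr P ε (coe_add u v) (EventuallyEq.refl _ _)),
      gagliardo_add_left, potential_add_left,
      integral_add' (integrable_gagliardo u w) (integrable_gagliardo v w),
      integral_add' (integrable_potential u w) (integrable_potential v w)]
    ring
  smul_left u v c := by
    simp only [innerε, conj_trivial]
    rw [integral_congr_ae (gagliardo_congr s (coe_smul c u) (EventuallyEq.refl _ _)),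
      integral_congr_ae (potential_congr P ε (coe_smul c u) (EventuallyEq.refl _ _)),
      gagliardo_smul_left, potential_smul_left]
    simp only [Pi.smul_apply, smul_eq_mul, integral_const_mul]
    ring
  definite u h := by
    have h1 : 0 ≤ ∫ p : E3 × E3, gagliardoIntegrand s u u p :=
      integral_nonneg (gagliardo_self_nonneg u)
    have h2 : 0 ≤ ∫ x : E3, potentialIntegrand P ε u u x :=
      integral_nonneg (potential_self_nonneg u)
    have h3 : ∫ x : E3, potentialIntegrand P ε u u x = 0 := by
      simp only [innerε] at h; linarith
    rw [integral_eq_zero_iff_of_nonneg (potential_self_nonneg u) (integrable_potential u u)] at h3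
    refine Subtype.ext (Lp.ext ?_)
    have h0 := Lp.coeFn_zero ℝ 2 (volume : Measure E3)
    filter_upwards [h3, h0] with x hx hx0
    have hV := P.pos (ε • x)
    have : (u : E3 → ℝ) x = 0 := by
      simpa [potentialIntegrand, hV.ne'] using hx
    exact this.trans hx0.symm

instance : NormedAddCommGroup (HSpace s P ε) := core.toNormedAddCommGroup

instance : InnerProductSpace ℝ (HSpace s P ε) := InnerProductSpace.ofCore core.toCore

lemma inner_eq (u v : HSpace s P ε) : inner ℝ u v =
    (∫ p : E3 × E3, gagliardoIntegrand s u v p) + ∫ x : E3, potentialIntegrand P ε u v x := rfl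

/-- `‖u‖_ε² = ∬ |u(x)-u(y)|²/|x-y|^{3+2s} dx dy + ∫ V(εx) u² dx`. -/
lemma norm_sq_eq (u : HSpace s P ε) : ‖u‖ ^ 2 =
    (∫ p : E3 × E3, (u p.1 - u p.2) ^ 2 / ‖p.1 - p.2‖ ^ (3 + 2 * s))
      + ∫ x : E3, P.V (ε • x) * u x ^ 2 := by
  rw [← real_inner_self_eq_norm_sq, inner_eq]
  simp only [gagliardoIntegrand, potentialIntegrand, sq]

end HSpace

/-! ### The functional and the Palais–Smale condition -/

/-- `J_ε(u) = ½ M̂(‖u‖_ε²) - ∫ G(εx, u(x)) dx` with `M̂(t) = ∫₀ᵗ M`. -/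
def energy (s : ℝ) (P : Potential) (ε : ℝ) (M f : ℝ → ℝ) (K a : ℝ) (Ω : Set E3)
    (u : HSpace s P ε) : ℝ :=
  (1 / 2) * (∫ τ in (0 : ℝ)..(‖u‖ ^ 2), M τ)
    - ∫ x : E3, penalizedPrimitive f P.V₀ K a Ω (ε • x) (u x)

/-- `(u_n)` is a Palais–Smale sequence for `J` at level `d`: `J(u_n) → d` and `J'(u_n) → 0` in the
norm of the dual space. -/
def IsPSSequence {X : Type*} [NormedAddCommGroup X] [NormedSpace ℝ X] (J : X → ℝ) (d : ℝ)
    (u : ℕ → X) : Prop :=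
  Tendsto (fun n => J (u n)) atTop (𝓝 d) ∧ Tendsto (fun n => fderiv ℝ J (u n)) atTop (𝓝 0)

/-- The Palais–Smale condition at level `d`: every Palais–Smale sequence at level `d` has a
(norm) convergent subsequence. -/
def PSCondition {X : Type*} [NormedAddCommGroup X] [NormedSpace ℝ X] (J : X → ℝ) (d : ℝ) : Prop :=
  ∀ u : ℕ → X, IsPSSequence J d u →
    ∃ (v : X) (φ : ℕ → ℕ), StrictMono φ ∧ Tendsto (fun n => u (φ n)) atTop (𝓝 v)

end FracKirchhoff

end

/-! Three mechanisms carry the proof.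

Subcritical analysis. Superlevel sets of `u` satisfy a recursive volume estimate, whose iteration
bounds all moments below the critical exponent 6/(3-2s) (`HSpace.exists_integral_rpow_le`). A
Poincaré inequality on small cubes makes weak null sequences vanish in L² on bounded sets
(`HSpace.tendsto_setIntegral_sq_of_weak`).

Regularity. For a nonlinearity of linear growth, the superposition functional is C¹ already on L². A
subcritical one is the limit of its cutoffs, and an exponent p strictly between q and the critical
one makes the derivatives converge uniformly on balls of H_ε
(`HSpace.exists_hasFDerivAt_of_growth`).

Compactness. The quotient condition on M gives ½M̂(t) - ¼M(t)t ≥ ¼m₀t. The Ambrosetti–Rabinowitz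
condition makes the interior nonlinear part of J - ¼J' nonnegative, while the exterior part costs at
most ‖u‖²/(4K). Since 1/K < m₀, Palais–Smale sequences are bounded
(`HSpace.bounded_of_isPSSequence`). Let v be a weak limit along a subsequence and test J'(u_n) with
w_n = u_n - v. On the bounded set where εx ∈ Ω the nonlinear term vanishes by local compactness.
Outside it the truncated nonlinearity is at most (V₀/K)|u_n|, so its quadratic part is absorbed by
the norm and leaves (m₀ - 1/K)‖w_n‖² → 0 (`HSpace.norm_sq_mul_le_of_weak_remainder`). Neither
tightness at infinity nor the equation satisfied by v is needed. -/

namespace FracKirchhoff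

/-! ### Weak sequential compactness in Hilbert spaces -/

/-- Every bounded sequence of a separable real Hilbert space has a weakly convergent
subsequence. -/
theorem exists_weakly_convergent_subseq_of_separable {Y : Type*} [NormedAddCommGroup Y]
    [InnerProductSpace ℝ Y] [CompleteSpace Y] [TopologicalSpace.SeparableSpace Y]
    (u : ℕ → Y) (R : ℝ) (hR : ∀ n, ‖u n‖ ≤ R) :
    ∃ (v : Y) (φ : ℕ → ℕ), StrictMono φ ∧
      ∀ y : Y, Tendsto (fun n => inner ℝ (u (φ n)) y) atTop (𝓝 (inner ℝ v y)) := by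
  let w : ℕ → WeakDual ℝ Y := fun n =>
    StrongDual.toWeakDual (InnerProductSpace.toDual ℝ Y (u n))
  have hw : ∀ n, w n ∈ WeakDual.toStrongDual ⁻¹' Metric.closedBall (0 : StrongDual ℝ Y) R := by
    intro n
    refine mem_closedBall_zero_iff.2 ?_
    exact ((InnerProductSpace.toDual ℝ Y).norm_map (u n)).trans_le (hR n)
  obtain ⟨ℓ, -, φ, hφ, hlim⟩ := WeakDual.isSeqCompact_closedBall ℝ Y 0 R hw
  refine ⟨(InnerProductSpace.toDual ℝ Y).symm (WeakDual.toStrongDual ℓ), φ, hφ, fun y => ?_⟩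
  rw [InnerProductSpace.toDual_symm_apply]
  exact ((WeakDual.eval_continuous y).tendsto ℓ).comp hlim

/-- Every bounded sequence of a real Hilbert space has a weakly convergent subsequence. -/
theorem exists_weakly_convergent_subseq {X : Type*} [NormedAddCommGroup X]
    [InnerProductSpace ℝ X] [CompleteSpace X] (u : ℕ → X) (R : ℝ) (hR : ∀ n, ‖u n‖ ≤ R) :
    ∃ (v : X) (φ : ℕ → ℕ), StrictMono φ ∧
      ∀ y : X, Tendsto (fun n => inner ℝ (u (φ n)) y) atTop (𝓝 (inner ℝ v y)) := by
  -- The closed span of the sequence is separable. Testing against y ∈ X is the same as testing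
  -- against its orthogonal projection onto this span.
  let Y : Submodule ℝ X := (Submodule.span ℝ (range u)).topologicalClosure
  have hYc : IsClosed (Y : Set X) := Submodule.isClosed_topologicalClosure _
  have : CompleteSpace Y := hYc.completeSpace_coe
  have hsep : TopologicalSpace.IsSeparable (Y : Set X) := by
    have : (Y : Set X) = closure (Submodule.span ℝ (range u) : Set X) :=
      Submodule.topologicalClosure_coe _
    rw [this]
    exact ((countable_range u).isSeparable.span (R := ℝ)).closure
  have : TopologicalSpace.SeparableSpace Y := hsep.separableSpace
  have hmem : ∀ n, u n ∈ Y := fun n =>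
    Submodule.le_topologicalClosure _ (Submodule.subset_span (mem_range_self n))
  obtain ⟨v, φ, hφ, h⟩ := exists_weakly_convergent_subseq_of_separable
    (fun n => (⟨u n, hmem n⟩ : Y)) R hR
  refine ⟨v, φ, hφ, fun y => ?_⟩
  have h2 := h (Y.orthogonalProjectionOnto y)
  simpa only [Submodule.inner_orthogonalProjectionOnto_eq_of_mem_left] using h2

/-! ### H_ε as a Hilbert space continuously included in L² -/

namespace HSpace

variable {s : ℝ} {P : Potential} {ε : ℝ}

lemma norm_sq_eq_add (u : HSpace s P ε) : ‖u‖ ^ 2 =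
    (∫ p : E3 × E3, gagliardoIntegrand s u u p) + ∫ x : E3, potentialIntegrand P ε u u x := by
  rw [← real_inner_self_eq_norm_sq, inner_eq]

lemma integral_gagliardo_le (u : HSpace s P ε) :
    ∫ p : E3 × E3, gagliardoIntegrand s u u p ≤ ‖u‖ ^ 2 := by
  have := integral_nonneg (μ := (volume : Measure E3)) (f := potentialIntegrand P ε u u)
    (potential_self_nonneg u)
  rw [norm_sq_eq_add]; linarith

lemma integral_potential_le (u : HSpace s P ε) :
    ∫ x : E3, potentialIntegrand P ε u u x ≤ ‖u‖ ^ 2 := by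
  have := integral_nonneg (μ := (volume : Measure (E3 × E3)))
    (f := gagliardoIntegrand s u u) (gagliardo_self_nonneg u)
  rw [norm_sq_eq_add]; linarith

lemma memLp_two (u : HSpace s P ε) : MemLp u 2 volume := Lp.memLp u.toL2

lemma integrable_sq (u : HSpace s P ε) : Integrable (fun x => u x ^ 2) :=
  u.memLp_two.integrable_sq

lemma integral_sq_le (u : HSpace s P ε) : P.V₀ * ∫ x, u x ^ 2 ≤ ‖u‖ ^ 2 := by
  refine le_trans ?_ u.integral_potential_le
  rw [← integral_const_mul]
  refine integral_mono (u.integrable_sq.const_mul _) (integrable_potential u u) fun x => ?_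
  simp only [potentialIntegrand, ← sq]
  exact mul_le_mul_of_nonneg_right (P.isGLB.1 (mem_range_self _)) (sq_nonneg _)

lemma coe_sub (u v : HSpace s P ε) : ⇑(u - v) =ᵐ[volume] ⇑u - ⇑v :=
  Lp.coeFn_sub u.toL2 v.toL2

lemma norm_toL2_sq (u : HSpace s P ε) : ‖u.toL2‖ ^ 2 = ∫ x, u x ^ 2 := by
  rw [← real_inner_self_eq_norm_sq, L2.inner_def]
  refine integral_congr_ae (Eventually.of_forall fun x => ?_)
  simp [toFun, sq]

lemma norm_toL2_le (u : HSpace s P ε) : ‖u.toL2‖ ≤ (Real.sqrt P.V₀)⁻¹ * ‖u‖ := by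
  have h0 := Real.sqrt_pos.2 P.V₀_pos
  rw [inv_mul_eq_div, le_div_iff₀ h0]
  refine abs_le_of_sq_le_sq' ?_ (norm_nonneg _) |>.2
  rw [mul_pow, Real.sq_sqrt P.V₀_pos.le, norm_toL2_sq, mul_comm]
  exact u.integral_sq_le

/-- The continuous inclusion of `H_ε` in `L²(ℝ³)`. -/
noncomputable def toL2CLM (s : ℝ) (P : Potential) (ε : ℝ) :
    HSpace s P ε →L[ℝ] Lp ℝ 2 (volume : Measure E3) :=
  LinearMap.mkContinuous
    { toFun := toL2, map_add' := fun _ _ => rfl, map_smul' := fun _ _ => rfl }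
    (Real.sqrt P.V₀)⁻¹ norm_toL2_le

lemma lintegral_ofReal_le_of_tendsto {α : Type*} [MeasurableSpace α] {μ : Measure α}
    {F : ℕ → α → ℝ} {F₀ : α → ℝ} {R : ℝ} (hF : ∀ n, Integrable (F n) μ) (hF0 : ∀ n x, 0 ≤ F n x)
    (hR : ∀ n, ∫ x, F n x ∂μ ≤ R) (hlim : ∀ᵐ x ∂μ, Tendsto (fun n => F n x) atTop (𝓝 (F₀ x))) :
    ∫⁻ x, ENNReal.ofReal (F₀ x) ∂μ ≤ ENNReal.ofReal R := by
  calc ∫⁻ x, ENNReal.ofReal (F₀ x) ∂μ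
      = ∫⁻ x, liminf (fun n => ENNReal.ofReal (F n x)) atTop ∂μ := by
        refine lintegral_congr_ae ?_
        filter_upwards [hlim] with x hx
        exact ((ENNReal.continuous_ofReal.tendsto _).comp hx).liminf_eq.symm
    _ ≤ liminf (fun n => ∫⁻ x, ENNReal.ofReal (F n x) ∂μ) atTop :=
        lintegral_liminf_le' fun n => (hF n).aemeasurable.ennreal_ofReal
    _ ≤ ENNReal.ofReal R := by
        refine liminf_le_of_le (by isBoundedDefault) fun b hb => ?_
        obtain ⟨n, hn⟩ := hb.exists
        refine hn.trans ?_
        rw [← ofReal_integral_eq_lintegral_ofReal (hF n) (Eventually.of_forall (hF0 n))]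
        exact ENNReal.ofReal_le_ofReal (hR n)

lemma integrable_and_integral_le_of_tendsto {α : Type*} [MeasurableSpace α] {μ : Measure α}
    {F : ℕ → α → ℝ} {F₀ : α → ℝ} {R : ℝ} (hF : ∀ n, Integrable (F n) μ) (hF0 : ∀ n x, 0 ≤ F n x)
    (hm : AEStronglyMeasurable F₀ μ) (h0 : ∀ x, 0 ≤ F₀ x)
    (hR : ∀ n, ∫ x, F n x ∂μ ≤ R) (hlim : ∀ᵐ x ∂μ, Tendsto (fun n => F n x) atTop (𝓝 (F₀ x))) :
    Integrable F₀ μ ∧ ∫ x, F₀ x ∂μ ≤ R := by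
  have h := lintegral_ofReal_le_of_tendsto hF hF0 hR hlim
  have hR0 : 0 ≤ R := (integral_nonneg (hF0 0)).trans (hR 0)
  refine ⟨⟨hm, ?_⟩, ?_⟩
  · rw [hasFiniteIntegral_iff_ofReal (Eventually.of_forall h0)]
    exact h.trans_lt ENNReal.ofReal_lt_top
  · rw [integral_eq_lintegral_of_nonneg_ae (Eventually.of_forall h0) hm]
    exact ENNReal.toReal_le_of_le_ofReal hR0 h

/-- A Fatou property of the norm of `H_ε`. -/
lemma exists_of_tendsto_ae {w : ℕ → HSpace s P ε} {R : ℝ} (hR : ∀ n, ‖w n‖ ≤ R)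
    (v : Lp ℝ 2 (volume : Measure E3))
    (hlim : ∀ᵐ x, Tendsto (fun n => w n x) atTop (𝓝 (v x))) :
    ∃ u : HSpace s P ε, u.toL2 = v ∧ ‖u‖ ^ 2 ≤ 2 * R ^ 2 := by
  have hR2 : ∀ n, ‖w n‖ ^ 2 ≤ R ^ 2 := fun n => pow_le_pow_left₀ (norm_nonneg _) (hR n) 2
  have mv := Lp.aestronglyMeasurable v
  have h1 := (Measure.quasiMeasurePreserving_fst (μ := (volume : Measure E3))
    (ν := (volume : Measure E3))).ae hlim
  have h2 := (Measure.quasiMeasurePreserving_snd (μ := (volume : Measure E3))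
    (ν := (volume : Measure E3))).ae hlim
  have hg := integrable_and_integral_le_of_tendsto (R := R ^ 2)
    (F := fun n => gagliardoIntegrand s (w n) (w n)) (F₀ := gagliardoIntegrand s v v)
    (fun n => integrable_gagliardo _ _) (fun n => gagliardo_self_nonneg _)
    (gagliardo_aesm s mv mv) (gagliardo_self_nonneg _)
    (fun n => (integral_gagliardo_le _).trans (hR2 n)) (by
      filter_upwards [h1, h2] with p hp1 hp2
      exact ((hp1.sub hp2).mul (hp1.sub hp2)).div_const _)
  have hp := integrable_and_integral_le_of_tendsto (R := R ^ 2)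
    (F := fun n => potentialIntegrand P ε (w n) (w n)) (F₀ := potentialIntegrand P ε v v)
    (fun n => integrable_potential _ _) (fun n => potential_self_nonneg _)
    (potential_aesm P ε mv mv) (potential_self_nonneg _)
    (fun n => (integral_potential_le _).trans (hR2 n)) (by
      filter_upwards [hlim] with p hp1
      exact (hp1.mul hp1).const_mul _)
  let U : HSpace s P ε := (⟨v, hg.1, hp.1⟩ : energySubspace s P ε)
  refine ⟨U, rfl, ?_⟩
  -- Fatou is applied to the two integrals separately, each bounded by R². The resulting factor 2 is
  -- harmless for completeness.
  rw [norm_sq_eq_add U, two_mul]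
  exact add_le_add hg.2 hp.2

lemma toL2_injective : Function.Injective (toL2 : HSpace s P ε → _) := Subtype.val_injective

/-- A Cauchy sequence converges in L², hence almost everywhere along a subsequence. Fatou places the
limit in H_ε; applied again to the differences u_n - u_{φ(m)} as m → ∞, it upgrades the convergence
to the norm of H_ε. -/
instance : CompleteSpace (HSpace s P ε) := by
  refine Metric.complete_of_cauchySeq_tendsto fun u hu => ?_
  have hL : CauchySeq fun n => toL2CLM s P ε (u n) :=
    (toL2CLM s P ε).uniformContinuous.comp_cauchySeq hu
  obtain ⟨v, hv⟩ := cauchySeq_tendsto_of_complete hL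
  obtain ⟨φ, hφ, hae⟩ := (tendstoInMeasure_of_tendsto_Lp hv).exists_seq_tendsto_ae
  obtain ⟨R, hR⟩ := hu.norm_bddAbove
  have hR' : ∀ n, ‖u n‖ ≤ R := fun n => hR (mem_range_self n)
  obtain ⟨U, hU, -⟩ := exists_of_tendsto_ae (w := fun n => u (φ n)) (fun n => hR' _) v hae
  refine ⟨U, Metric.tendsto_atTop.2 fun e he => ?_⟩
  obtain ⟨N, hN⟩ := Metric.cauchySeq_iff.1 hu (e / 2) (by positivity)
  refine ⟨N, fun n hn => ?_⟩
  have hae' : ∀ᵐ x, Tendsto (fun m => (u n - u (φ (m + N))) x) atTop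
      (𝓝 ((u n - U).toL2 x)) := by
    have hall : ∀ᵐ x, ∀ m, (u n - u (φ (m + N))) x = u n x - u (φ (m + N)) x :=
      ae_all_iff.2 fun m => coe_sub _ _
    filter_upwards [hae, hall, coe_sub (u n) U] with x hx hall hUx
    have hUx' : (u n - U).toL2 x = u n x - v x := by rw [← hU]; exact hUx
    rw [hUx']
    simp only [hall]
    exact tendsto_const_nhds.sub (hx.comp (tendsto_add_atTop_nat N))
  obtain ⟨W, hW, hWn⟩ := exists_of_tendsto_ae (w := fun m => u n - u (φ (m + N))) (R := e / 2)
    (fun m => by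
      rw [← dist_eq_norm]
      exact (hN n hn _ ((Nat.le_add_left N m).trans (hφ.id_le _))).le) _ hae'
  rw [toL2_injective hW] at hWn
  rw [dist_eq_norm]
  nlinarith [norm_nonneg (u n - U)]

end HSpace

/-! ### Subcritical Sobolev embedding through superlevel sets -/

lemma volume_real_unitBall_pos : 0 < volume.real (Metric.ball (0 : E3) 1) :=
  ENNReal.toReal_pos (Metric.measure_ball_pos _ _ one_pos).ne' measure_ball_lt_top.ne

lemma volume_real_ball (x : E3) {r : ℝ} (hr : 0 ≤ r) :
    volume.real (Metric.ball x r) = r ^ 3 * volume.real (Metric.ball (0 : E3) 1) := by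
  rw [measureReal_def, Measure.addHaar_ball volume x hr, ENNReal.toReal_mul,
    ENNReal.toReal_ofReal (by positivity), finrank_euclideanSpace_fin]
  rfl

/-- The tail of the fractional kernel outside a set of finite measure. -/
lemma exists_le_lintegral_compl_kernel {s : ℝ} (hs : 0 < s) :
    ∃ c : ℝ, 0 < c ∧ ∀ E : Set E3, MeasurableSet E → volume E ≠ ∞ → 0 < volume.real E →
      ∀ x ∈ E, ENNReal.ofReal (c * volume.real E ^ (-(2 * s / 3))) ≤
        ∫⁻ y in Eᶜ, ENNReal.ofReal (1 / ‖x - y‖ ^ (3 + 2 * s)) := by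
  set ω := volume.real (Metric.ball (0 : E3) 1) with hω
  have hω0 : 0 < ω := volume_real_unitBall_pos
  refine ⟨(2 / ω) ^ (-(1 + 2 * s / 3)), by positivity, fun E hE hfin hm x hx => ?_⟩
  set m := volume.real E with hmdef
  -- With this radius the ball about x has volume 2m, so at least m of it lies outside E, and there
  -- the kernel is at least r^{-(3+2s)}.
  set r : ℝ := (2 * m / ω) ^ (1 / 3 : ℝ) with hr
  have hr0 : 0 < r := by positivity
  have hr3 : r ^ 3 = 2 * m / ω := by
    rw [hr, ← Real.rpow_natCast, ← Real.rpow_mul (by positivity)]; norm_num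
  have hball : volume.real (Metric.ball x r) = 2 * m := by
    rw [volume_real_ball x hr0.le, hr3, ← hω]; field_simp
  have hpow : r ^ (-(3 + 2 * s)) * m = (2 / ω) ^ (-(1 + 2 * s / 3)) * m ^ (-(2 * s / 3)) := by
    rw [hr, ← Real.rpow_mul (by positivity), show 2 * m / ω = 2 / ω * m by ring,
      Real.mul_rpow (by positivity) hm.le]
    rw [show (1 / 3 : ℝ) * -(3 + 2 * s) = -(1 + 2 * s / 3) by ring, mul_assoc]
    rw [show -(2 * s / 3) = -(1 + 2 * s / 3) + 1 by ring, Real.rpow_add hm, Real.rpow_one]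
  have hdiff : ENNReal.ofReal m ≤ volume (Metric.ball x r \ E) := by
    refine le_trans ?_ le_measure_sdiff
    rw [← ENNReal.ofReal_toReal hfin, ← ENNReal.ofReal_toReal measure_ball_lt_top.ne]
    change _ ≤ ENNReal.ofReal (volume.real _) - ENNReal.ofReal (volume.real E)
    rw [hball, ← ENNReal.ofReal_sub _ hm.le]
    exact ENNReal.ofReal_le_ofReal (by linarith)
  calc ENNReal.ofReal ((2 / ω) ^ (-(1 + 2 * s / 3)) * m ^ (-(2 * s / 3)))
      = ENNReal.ofReal (r ^ (-(3 + 2 * s))) * ENNReal.ofReal m := by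
        rw [← hpow, ENNReal.ofReal_mul (by positivity)]
    _ ≤ ENNReal.ofReal (r ^ (-(3 + 2 * s))) * volume (Metric.ball x r \ E) := by gcongr
    _ = ∫⁻ y in Metric.ball x r \ E, ENNReal.ofReal (r ^ (-(3 + 2 * s))) :=
        (setLIntegral_const _ _).symm
    _ ≤ ∫⁻ y in Metric.ball x r \ E, ENNReal.ofReal (1 / ‖x - y‖ ^ (3 + 2 * s)) := by
        refine setLIntegral_mono' (measurableSet_ball.diff hE) fun y hy => ?_
        refine ENNReal.ofReal_le_ofReal ?_
        have hxy : 0 < ‖x - y‖ := norm_pos_iff.2 (sub_ne_zero.2 fun h => hy.2 (h ▸ hx))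
        have hlt : ‖x - y‖ ≤ r := by
          have := hy.1
          rw [Metric.mem_ball, dist_comm, dist_eq_norm] at this
          exact this.le
        rw [Real.rpow_neg hr0.le, ← one_div]
        exact one_div_le_one_div_of_le (by positivity)
          (Real.rpow_le_rpow hxy.le hlt (by positivity))
    _ ≤ _ := lintegral_mono_set fun y hy => hy.2

namespace HSpace

variable {s : ℝ} {P : Potential} {ε : ℝ}

lemma measurable_coe (u : HSpace s P ε) : Measurable u :=
  (Lp.stronglyMeasurable u.toL2).measurable

/-- The superlevel set `{|u| ≥ t}`. -/
def superlevel (u : HSpace s P ε) (t : ℝ) : Set E3 := {x | t ≤ |u x|}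

lemma measurableSet_superlevel (u : HSpace s P ε) (t : ℝ) : MeasurableSet (u.superlevel t) :=
  measurableSet_le measurable_const u.measurable_coe.abs

lemma superlevel_sq_lintegral (u : HSpace s P ε) {t : ℝ} (ht : 0 < t) :
    ENNReal.ofReal (t ^ 2) * volume (u.superlevel t) ≤ ENNReal.ofReal (∫ x, u x ^ 2) := by
  rw [ofReal_integral_eq_lintegral_ofReal u.integrable_sq
    (Eventually.of_forall fun x => sq_nonneg _)]
  refine le_trans ?_ (mul_meas_ge_le_lintegral₀ u.integrable_sq.aemeasurable.ennreal_ofReal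
    (ENNReal.ofReal (t ^ 2)))
  gcongr
  intro x hx
  refine ENNReal.ofReal_le_ofReal ?_
  rw [← sq_abs (u x)]
  exact pow_le_pow_left₀ ht.le hx 2

lemma volume_superlevel_ne_top (u : HSpace s P ε) {t : ℝ} (ht : 0 < t) :
    volume (u.superlevel t) ≠ ∞ := by
  intro h
  have := u.superlevel_sq_lintegral ht
  rw [h, ENNReal.mul_top (by simpa using ht.ne')] at this
  exact ENNReal.ofReal_ne_top (top_le_iff.1 this)

lemma volume_superlevel_one_le (u : HSpace s P ε) :
    volume.real (u.superlevel 1) ≤ ‖u‖ ^ 2 / P.V₀ := by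
  have h := u.superlevel_sq_lintegral one_pos
  rw [one_pow, ENNReal.ofReal_one, one_mul] at h
  have h2 := ENNReal.toReal_le_of_le_ofReal (integral_nonneg fun x => sq_nonneg _) h
  refine h2.trans ?_
  rw [le_div_iff₀ P.V₀_pos, mul_comm]
  exact u.integral_sq_le

/-- If |u(x)| ≥ 2t and |u(y)| < t, then |u(x) - u(y)| ≥ t. Restricting the Gagliardo integral to
such pairs and bounding the kernel tail over y from below gives a recursion between the volumes at
levels t and 2t. -/
lemma exists_superlevel_two_mul_le (hs : 0 < s) : ∃ c : ℝ, 0 < c ∧ ∀ (u : HSpace s P ε) (t : ℝ),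
    0 < t → c * t ^ 2 * volume.real (u.superlevel (2 * t)) ≤
      ‖u‖ ^ 2 * volume.real (u.superlevel t) ^ (2 * s / 3) := by
  obtain ⟨c, hc, hker⟩ := exists_le_lintegral_compl_kernel hs
  refine ⟨c, hc, fun u t ht => ?_⟩
  set E := u.superlevel t with hE
  have hsub : u.superlevel (2 * t) ⊆ E := fun x hx => (by linarith : t ≤ 2 * t).trans hx
  have hfin : volume E ≠ ∞ := u.volume_superlevel_ne_top ht
  rcases (measureReal_nonneg (μ := volume) (s := E)).eq_or_lt with h0 | hm
  · have : volume.real (u.superlevel (2 * t)) ≤ 0 := by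
      rw [h0]; exact measureReal_mono hsub hfin
    rw [le_antisymm this measureReal_nonneg, mul_zero]
    positivity
  have hEm : MeasurableSet E := u.measurableSet_superlevel t
  have key : volume (u.superlevel (2 * t)) *
      ENNReal.ofReal (t ^ 2 * (c * volume.real E ^ (-(2 * s / 3)))) ≤ ENNReal.ofReal (‖u‖ ^ 2) := by
    calc volume (u.superlevel (2 * t)) *
        ENNReal.ofReal (t ^ 2 * (c * volume.real E ^ (-(2 * s / 3))))
        = ∫⁻ x in u.superlevel (2 * t),
          ENNReal.ofReal (t ^ 2 * (c * volume.real E ^ (-(2 * s / 3)))) := by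
          rw [setLIntegral_const, mul_comm]
      _ ≤ ∫⁻ x in u.superlevel (2 * t), ∫⁻ y in Eᶜ,
          ENNReal.ofReal (gagliardoIntegrand s u u (x, y)) := by
          refine setLIntegral_mono' (u.measurableSet_superlevel _) fun x hx => ?_
          rw [ENNReal.ofReal_mul (by positivity)]
          refine (mul_le_mul_right (hker E hEm hfin hm x (hsub hx)) _).trans ?_
          rw [← lintegral_const_mul' _ _ ENNReal.ofReal_ne_top]
          refine setLIntegral_mono' hEm.compl fun y hy => ?_
          rw [← ENNReal.ofReal_mul (by positivity), mul_one_div]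
          refine ENNReal.ofReal_le_ofReal (div_le_div_of_nonneg_right ?_ (by positivity))
          have hx' : 2 * t ≤ |u x| := hx
          have hy' : |u y| < t := not_le.1 hy
          have h3 : t ≤ |u x - u y| := by linarith [abs_sub_abs_le_abs_sub (u x) (u y)]
          rw [← sq, ← sq_abs (u x - u y)]
          exact pow_le_pow_left₀ ht.le h3 2
      _ ≤ ∫⁻ x, ∫⁻ y, ENNReal.ofReal (gagliardoIntegrand s u u (x, y)) :=
          (setLIntegral_le_lintegral _ _).trans
            (lintegral_mono fun x => setLIntegral_le_lintegral _ _)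
      _ = ∫⁻ p : E3 × E3, ENNReal.ofReal (gagliardoIntegrand s u u p) :=
          (lintegral_prod _ (integrable_gagliardo u u).aemeasurable.ennreal_ofReal).symm
      _ = ENNReal.ofReal (∫ p : E3 × E3, gagliardoIntegrand s u u p) :=
          (ofReal_integral_eq_lintegral_ofReal (integrable_gagliardo u u)
            (Eventually.of_forall (gagliardo_self_nonneg u))).symm
      _ ≤ _ := ENNReal.ofReal_le_ofReal u.integral_gagliardo_le
  have h2 := ENNReal.toReal_le_of_le_ofReal (by positivity) key
  rw [ENNReal.toReal_mul, ENNReal.toReal_ofReal (by positivity)] at h2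
  change volume.real _ * _ ≤ _ at h2
  rw [Real.rpow_neg hm.le] at h2
  have hp : 0 < volume.real E ^ (2 * s / 3) := by positivity
  calc c * t ^ 2 * volume.real (u.superlevel (2 * t))
      = volume.real (u.superlevel (2 * t)) * (t ^ 2 * (c * (volume.real E ^ (2 * s / 3))⁻¹))
        * volume.real E ^ (2 * s / 3) := by field_simp
    _ ≤ _ := mul_le_mul_of_nonneg_right h2 hp.le

/-- The weak form of the Sobolev inequality, along dyadic levels. -/
lemma exists_superlevel_two_pow_le (hs : 0 < s) (hs' : s < 1) {p : ℝ}
    (hp' : p ≤ 6 / (3 - 2 * s)) (R : ℝ) :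
    ∃ D : ℝ, 0 ≤ D ∧ ∀ u : HSpace s P ε, ‖u‖ ≤ R → ∀ k : ℕ,
      volume.real (u.superlevel (2 ^ k)) ≤ D * (2 : ℝ) ^ (-(p * k)) := by
  obtain ⟨c, hc, hstep⟩ := exists_superlevel_two_mul_le (P := P) (ε := ε) hs
  set σ := 2 * s / 3 with hσ
  have hσ1 : 0 < 1 - σ := by rw [hσ]; linarith
  -- This is where the critical exponent enters: p(1 - σ) ≤ 2 says exactly that p ≤ 6/(3-2s), and it
  -- keeps the decay rate 2^{-pk} stable under the recursion.
  have hpσ : p * (1 - σ) ≤ 2 := by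
    rw [le_div_iff₀ (by linarith)] at hp'
    rw [hσ]; linarith
  set C : ℝ := (R ^ 2 + 1) / c with hC
  have hC0 : 0 < C := by positivity
  -- The first entry starts the induction at level 1 by Chebyshev; the second gives C·D^σ ≤
  -- D·2^{-p}, which closes the inductive step.
  set D : ℝ := max (R ^ 2 / P.V₀) ((C * 2 ^ p) ^ (1 / (1 - σ))) with hD
  have hD0 : 0 < D := lt_max_of_lt_right (by positivity)
  have hDσ : C * 2 ^ p ≤ D ^ (1 - σ) := by
    calc C * 2 ^ p = ((C * 2 ^ p) ^ (1 / (1 - σ))) ^ (1 - σ) := by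
          rw [← Real.rpow_mul (by positivity), one_div_mul_cancel hσ1.ne', Real.rpow_one]
      _ ≤ _ := Real.rpow_le_rpow (by positivity) (le_max_right _ _) hσ1.le
  refine ⟨D, hD0.le, fun u hu k => ?_⟩
  have hu2 : ‖u‖ ^ 2 ≤ R ^ 2 := pow_le_pow_left₀ (norm_nonneg _) hu 2
  induction k with
  | zero =>
    simp only [pow_zero, Nat.cast_zero, mul_zero, neg_zero, Real.rpow_zero, mul_one]
    refine u.volume_superlevel_one_le.trans (le_trans ?_ (le_max_left _ _))
    exact div_le_div_of_nonneg_right hu2 P.V₀_pos.le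
  | succ k ih =>
    have h := hstep u (2 ^ k) (by positivity)
    rw [← pow_succ'] at h
    have e4 : ((2 : ℝ) ^ k) ^ 2 = 2 ^ (2 * (k : ℝ)) := by
      rw [← pow_mul, ← Real.rpow_natCast]; push_cast; ring_nf
    have hA : c * ((2 : ℝ) ^ k) ^ 2 * volume.real (u.superlevel (2 ^ (k + 1))) ≤
        (R ^ 2 + 1) * (D ^ σ * 2 ^ (-(p * σ * k))) := by
      refine h.trans (mul_le_mul (by linarith) ?_ (by positivity) (by positivity))
      calc volume.real (u.superlevel (2 ^ k)) ^ σ ≤ (D * (2 : ℝ) ^ (-(p * k))) ^ σ :=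
            Real.rpow_le_rpow measureReal_nonneg ih (by rw [hσ]; positivity)
        _ = D ^ σ * 2 ^ (-(p * σ * k)) := by
            rw [Real.mul_rpow hD0.le (by positivity), ← Real.rpow_mul (by norm_num)]
            ring_nf
    have hB : volume.real (u.superlevel (2 ^ (k + 1))) ≤
        C * D ^ σ * 2 ^ (-(p * σ * k) - 2 * k) := by
      rw [Real.rpow_sub (by norm_num), ← e4, hC]
      rw [show (R ^ 2 + 1) / c * D ^ σ * (2 ^ (-(p * σ * k)) / ((2 : ℝ) ^ k) ^ 2)
        = ((R ^ 2 + 1) * (D ^ σ * 2 ^ (-(p * σ * k)))) / (c * ((2 : ℝ) ^ k) ^ 2) by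
          field_simp, le_div_iff₀ (by positivity), mul_comm]
      exact hA
    refine hB.trans ?_
    have hk : (2 : ℝ) ^ (-(p * σ * k) - 2 * k) ≤ 2 ^ (-(p * k)) := by
      refine Real.rpow_le_rpow_of_exponent_le (by norm_num) ?_
      nlinarith [(Nat.cast_nonneg k : (0 : ℝ) ≤ k)]
    have hCD : C * D ^ σ ≤ D * 2 ^ (-p) := by
      rw [Real.rpow_neg (by norm_num), ← div_eq_mul_inv, le_div_iff₀ (by positivity)]
      calc C * D ^ σ * 2 ^ p = C * 2 ^ p * D ^ σ := by ring
        _ ≤ D ^ (1 - σ) * D ^ σ := mul_le_mul_of_nonneg_right hDσ (by positivity)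
        _ = D := by rw [← Real.rpow_add hD0]; simp
    calc C * D ^ σ * 2 ^ (-(p * σ * k) - 2 * k) ≤ (D * 2 ^ (-p)) * 2 ^ (-(p * k)) :=
          mul_le_mul hCD hk (by positivity) (by positivity)
      _ = _ := by
          rw [mul_assoc, ← Real.rpow_add (by norm_num)]; push_cast; ring_nf

/-- The subcritical fractional Sobolev embedding. -/
theorem exists_integral_rpow_le (hs : 0 < s) (hs' : s < 1) {p : ℝ} (hp : 2 ≤ p)
    (hp' : p < 6 / (3 - 2 * s)) (R : ℝ) :
    ∃ C : ℝ, 0 ≤ C ∧ ∀ u : HSpace s P ε, ‖u‖ ≤ R →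
      Integrable (fun x => |u x| ^ p) ∧ ∫ x, |u x| ^ p ≤ C := by
  set r := 6 / (3 - 2 * s) with hr
  obtain ⟨D, hD, hlev⟩ := exists_superlevel_two_pow_le (P := P) (ε := ε) hs hs'
    (p := r) le_rfl R
  -- The layer 2^k ≤ |u| < 2^{k+1} contributes at most 2^{p(k+1)}·D·2^{-rk}, a geometric series of
  -- ratio 2^{p-r} < 1. Where |u| < 1, the bound |u|^p ≤ u² suffices.
  set ρ : ℝ := 2 ^ (p - r) with hρ
  have hρ0 : 0 < ρ := by positivity
  have hρ1 : ρ < 1 := Real.rpow_lt_one_of_one_lt_of_neg (by norm_num) (by linarith)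
  have hsum : Summable fun k : ℕ => D * 2 ^ p * ρ ^ k :=
    (summable_geometric_of_lt_one hρ0.le hρ1).mul_left _
  set C : ℝ := R ^ 2 / P.V₀ + ∑' k : ℕ, D * 2 ^ p * ρ ^ k with hC
  have hV := P.V₀_pos
  have hts : 0 ≤ ∑' k : ℕ, D * 2 ^ p * ρ ^ k := tsum_nonneg fun k => by positivity
  have hC0 : 0 ≤ C := by positivity
  refine ⟨C, hC0, fun u hu => ?_⟩
  have hmeas : Measurable fun x => |u x| ^ p := u.measurable_coe.abs.pow_const p
  have hpt : ∀ x, ENNReal.ofReal (|u x| ^ p) ≤ ENNReal.ofReal (u x ^ 2) +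
      ∑' k : ℕ, (u.superlevel (2 ^ k)).indicator
        (fun _ => ENNReal.ofReal (2 ^ (p * (k + 1)))) x := by
    intro x
    rcases le_or_gt 1 (|u x|) with h1 | h1
    · obtain ⟨k, hk1, hk2⟩ := exists_nat_pow_near h1 (one_lt_two)
      refine le_add_left ((le_trans ?_ (ENNReal.le_tsum k)))
      rw [indicator_of_mem (show x ∈ u.superlevel (2 ^ k) from hk1)]
      refine ENNReal.ofReal_le_ofReal ?_
      rw [mul_comm, Real.rpow_mul (by norm_num)]
      refine Real.rpow_le_rpow (abs_nonneg _) ?_ (by linarith)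
      rw [← Nat.cast_succ, Real.rpow_natCast]; exact hk2.le
    · refine le_add_right (ENNReal.ofReal_le_ofReal ?_)
      rw [← sq_abs, ← Real.rpow_natCast]
      exact Real.rpow_le_rpow_of_exponent_ge' (abs_nonneg _) h1.le (by norm_num)
        (by exact_mod_cast hp)
  have hbound : ∫⁻ x, ENNReal.ofReal (|u x| ^ p) ≤ ENNReal.ofReal C := by
    refine (lintegral_mono hpt).trans ?_
    rw [lintegral_add_left (u.measurable_coe.pow_const 2).ennreal_ofReal,
      lintegral_tsum fun k => (measurable_const.indicator
        (u.measurableSet_superlevel _)).aemeasurable, hC, ENNReal.ofReal_add (by positivity) hts,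
      ENNReal.ofReal_tsum_of_nonneg (fun k => by positivity) hsum,
      ← ofReal_integral_eq_lintegral_ofReal u.integrable_sq
        (Eventually.of_forall fun x => sq_nonneg _)]
    refine add_le_add (ENNReal.ofReal_le_ofReal ?_) (ENNReal.tsum_le_tsum fun k => ?_)
    · rw [le_div_iff₀ hV, mul_comm]
      exact u.integral_sq_le.trans (pow_le_pow_left₀ (norm_nonneg _) hu 2)
    · rw [lintegral_indicator_const (u.measurableSet_superlevel _),
        ← ENNReal.ofReal_toReal (u.volume_superlevel_ne_top (t := 2 ^ k) (by positivity)),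
        ← ENNReal.ofReal_mul (by positivity)]
      refine ENNReal.ofReal_le_ofReal ?_
      calc (2 : ℝ) ^ (p * (k + 1)) * volume.real (u.superlevel (2 ^ k))
          ≤ 2 ^ (p * (k + 1)) * (D * (2 : ℝ) ^ (-(r * k))) :=
            mul_le_mul_of_nonneg_left (hlev u hu k) (by positivity)
        _ = D * 2 ^ p * ρ ^ k := by
            rw [hρ, ← Real.rpow_natCast, ← Real.rpow_mul (by norm_num), mul_left_comm, mul_assoc,
              ← Real.rpow_add (by norm_num), ← Real.rpow_add (by norm_num)]
            ring_nf
  have hn : ∀ x, 0 ≤ |u x| ^ p := fun x => by positivity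
  refine ⟨⟨hmeas.aestronglyMeasurable, ?_⟩, ?_⟩
  · rw [hasFiniteIntegral_iff_ofReal (Eventually.of_forall hn)]
    exact hbound.trans_lt ENNReal.ofReal_lt_top
  · rw [integral_eq_lintegral_of_nonneg_ae (Eventually.of_forall hn) hmeas.aestronglyMeasurable]
    exact ENNReal.toReal_le_of_le_ofReal hC0 hbound

end HSpace

/-! ### Local compactness: Poincaré inequality on small cubes -/

/-- The variance identity, obtained by expanding the square and applying Fubini. It turns a bound on
double differences into a Poincaré inequality. -/
lemma integral_sub_sq_prod {α : Type*} [MeasurableSpace α] (μ : Measure α) [IsFiniteMeasure μ]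
    {w : α → ℝ} (hw : MemLp w 2 μ) :
    ∫ p : α × α, (w p.1 - w p.2) ^ 2 ∂(μ.prod μ) =
      2 * (μ.real univ * ∫ x, w x ^ 2 ∂μ - (∫ x, w x ∂μ) ^ 2) := by
  have h1 : Integrable w μ := hw.integrable (by norm_num)
  have h2 := hw.integrable_sq
  have i1 : Integrable (fun p : α × α => w p.1 ^ 2) (μ.prod μ) := h2.comp_fst μ
  have i2 : Integrable (fun p : α × α => w p.2 ^ 2) (μ.prod μ) := h2.comp_snd μ
  have i3 : Integrable (fun p : α × α => w p.1 * w p.2) (μ.prod μ) := h1.mul_prod h1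
  have e : (fun p : α × α => (w p.1 - w p.2) ^ 2) =
      fun p => w p.1 ^ 2 + w p.2 ^ 2 - 2 * (w p.1 * w p.2) := by
    funext p; ring
  rw [e, integral_sub (f := fun p : α × α => w p.1 ^ 2 + w p.2 ^ 2) (i1.add i2) (i3.const_mul 2),
    integral_add i1 i2, integral_const_mul,
    integral_prod_mul, integral_fun_fst (fun x => w x ^ 2), integral_fun_snd (fun x => w x ^ 2)]
  simp only [smul_eq_mul]
  ring

/-- The cubes of side `r` whose vertices lie in `rℤ³`. -/
def cube (r : ℝ) (i : Fin 3 → ℤ) : Set E3 := {x | (fun j => ⌊x j / r⌋) = i}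

lemma measurableSet_cube (r : ℝ) (i : Fin 3 → ℤ) : MeasurableSet (cube r i) := by
  have : cube r i = ⋂ j, {x : E3 | ⌊x j / r⌋ = i j} := by
    ext x; simp [cube, funext_iff]
  rw [this]
  refine MeasurableSet.iInter fun j => ?_
  have hm : Measurable fun x : E3 => ⌊x j / r⌋ :=
    Int.measurable_floor.comp (by fun_prop)
  exact hm (measurableSet_singleton (i j))

lemma disjoint_cube (r : ℝ) {i i' : Fin 3 → ℤ} (h : i ≠ i') : Disjoint (cube r i) (cube r i') :=
  Set.disjoint_left.2 fun _ hx hx' => h (Eq.trans (Eq.symm hx) hx')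

lemma norm_sub_le_of_mem_cube {r : ℝ} (hr : 0 < r) {i : Fin 3 → ℤ} {x y : E3} (hx : x ∈ cube r i)
    (hy : y ∈ cube r i) : ‖x - y‖ ≤ 2 * r := by
  have h : ∀ j, |x j - y j| ≤ r := by
    intro j
    have := Int.abs_sub_lt_one_of_floor_eq_floor
      ((congrFun hx j).trans (congrFun hy j).symm)
    rw [← sub_div, abs_div, abs_of_pos hr, div_lt_one hr] at this
    exact this.le
  rw [EuclideanSpace.norm_eq, Real.sqrt_le_left (by positivity), Fin.sum_univ_three]
  simp only [PiLp.sub_apply, Real.norm_eq_abs]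
  nlinarith [h 0, h 1, h 2, abs_nonneg (x 0 - y 0), abs_nonneg (x 1 - y 1),
    abs_nonneg (x 2 - y 2)]

lemma exists_ball_subset_cube {r : ℝ} (hr : 0 < r) (i : Fin 3 → ℤ) :
    ∃ c : E3, Metric.ball c (r / 2) ⊆ cube r i := by
  refine ⟨WithLp.toLp 2 fun j => (i j + 1 / 2) * r, fun x hx => ?_⟩
  rw [Metric.mem_ball, dist_eq_norm] at hx
  funext j
  have h := (PiLp.norm_apply_le (x - WithLp.toLp 2 fun j => ((i j : ℝ) + 1 / 2) * r) j).trans_lt hx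
  simp only [PiLp.sub_apply, Real.norm_eq_abs, abs_lt] at h
  rw [Int.floor_eq_iff, le_div_iff₀ hr, div_lt_iff₀ hr]
  constructor <;> nlinarith [h.1, h.2]

lemma volume_cube_ne_top {r : ℝ} (hr : 0 < r) (i : Fin 3 → ℤ) : volume (cube r i) ≠ ∞ := by
  obtain ⟨c, hc⟩ := exists_ball_subset_cube hr i
  have hcm : c ∈ cube r i := hc (Metric.mem_ball_self (by positivity))
  refine ((measure_mono fun x hx => ?_).trans_lt
    (measure_closedBall_lt_top (x := c) (r := 2 * r))).ne
  rw [Metric.mem_closedBall, dist_eq_norm]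
  exact norm_sub_le_of_mem_cube hr hx hcm

lemma le_volume_cube {r : ℝ} (hr : 0 < r) (i : Fin 3 → ℤ) :
    (r / 2) ^ 3 * volume.real (Metric.ball (0 : E3) 1) ≤ volume.real (cube r i) := by
  obtain ⟨c, hc⟩ := exists_ball_subset_cube hr i
  rw [← volume_real_ball c (by positivity)]
  exact measureReal_mono hc (volume_cube_ne_top hr i)

lemma exists_finset_cubes_cover {r : ℝ} (hr : 0 < r) {B : Set E3} (hB : Bornology.IsBounded B) :
    ∃ I : Finset (Fin 3 → ℤ), B ⊆ ⋃ i ∈ I, cube r i := by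
  obtain ⟨ρ, hρ⟩ := hB.exists_norm_le
  refine ⟨Fintype.piFinset fun _ => Finset.Icc ⌊-ρ / r⌋ ⌊ρ / r⌋, fun x hx => ?_⟩
  refine mem_iUnion₂.2 ⟨fun j => ⌊x j / r⌋, Fintype.mem_piFinset.2 fun j => ?_, rfl⟩
  have h : |x j| ≤ ρ := (PiLp.norm_apply_le x j).trans (hρ x hx)
  rw [abs_le] at h
  exact Finset.mem_Icc.2 ⟨Int.floor_le_floor (div_le_div_of_nonneg_right h.1 hr.le),
    Int.floor_le_floor (div_le_div_of_nonneg_right h.2 hr.le)⟩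

namespace HSpace

variable {s : ℝ} {P : Potential} {ε : ℝ}

/-- A Poincaré inequality on a set of small diameter. -/
lemma measure_mul_setIntegral_sq_le (hs : 0 < s) (w : HSpace s P ε) {E : Set E3}
    (hE : MeasurableSet E) (hfin : volume E ≠ ∞) {d : ℝ}
    (hd : ∀ x ∈ E, ∀ y ∈ E, ‖x - y‖ ≤ d) :
    volume.real E * ∫ x in E, w x ^ 2 ≤ (∫ x in E, w x) ^ 2 +
      d ^ (3 + 2 * s) * ∫ p in E ×ˢ E, gagliardoIntegrand s w w p := by
  have : IsFiniteMeasure (volume.restrict E) := ⟨by simpa using hfin.lt_top⟩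
  have hw : MemLp w 2 (volume.restrict E) := w.memLp_two.restrict E
  have h := integral_sub_sq_prod (volume.restrict E) hw
  rw [measureReal_restrict_apply_univ, Measure.prod_restrict, ← Measure.volume_eq_prod] at h
  have hg : 0 ≤ ∫ p in E ×ˢ E, gagliardoIntegrand s w w p :=
    integral_nonneg (gagliardo_self_nonneg w)
  have hle : ∫ p in E ×ˢ E, (w p.1 - w p.2) ^ 2 ≤
      d ^ (3 + 2 * s) * ∫ p in E ×ˢ E, gagliardoIntegrand s w w p := by
    rw [← integral_const_mul]
    refine integral_mono_of_nonneg (Eventually.of_forall fun p => sq_nonneg _)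
      ((integrable_gagliardo w w).integrableOn.const_mul _) ?_
    refine (ae_restrict_iff' (hE.prod hE)).2 (Eventually.of_forall fun p hp => ?_)
    have hdp := hd p.1 hp.1 p.2 hp.2
    rcases (norm_nonneg (p.1 - p.2)).eq_or_lt with h0 | h0
    · have : p.1 = p.2 := sub_eq_zero.1 (norm_eq_zero.1 h0.symm)
      simp [gagliardoIntegrand, this]
    · simp only [gagliardoIntegrand, ← sq]
      rw [mul_div_assoc', le_div_iff₀ (by positivity), mul_comm]
      gcongr
  -- The variance identity provides a factor ½ that the conclusion drops, hence the need for this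
  -- sign. It is read off from the preceding chain because d itself carries no sign assumption when
  -- E is empty.
  have hd0 : 0 ≤ d ^ (3 + 2 * s) * ∫ p in E ×ˢ E, gagliardoIntegrand s w w p :=
    (integral_nonneg fun p => sq_nonneg _).trans hle
  linarith

/-- The Poincaré inequality is summed over the cubes. The products of a cube with itself are
pairwise disjoint, so their Gagliardo energies add up to at most ‖w‖², whatever the number of cubes.
-/
lemma setIntegral_sq_le_of_cover (hs : 0 < s) (w : HSpace s P ε) {r : ℝ} (hr : 0 < r) {B : Set E3}
    {I : Finset (Fin 3 → ℤ)} (hI : B ⊆ ⋃ i ∈ I, cube r i) :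
    ∫ x in B, w x ^ 2 ≤ ((r / 2) ^ 3 * volume.real (Metric.ball (0 : E3) 1))⁻¹ *
      (∑ i ∈ I, (∫ x in cube r i, w x) ^ 2 + (2 * r) ^ (3 + 2 * s) * ‖w‖ ^ 2) := by
  set b := (r / 2) ^ 3 * volume.real (Metric.ball (0 : E3) 1) with hb
  have hb0 : 0 < b := mul_pos (by positivity) volume_real_unitBall_pos
  rw [inv_mul_eq_div, le_div_iff₀ hb0, mul_comm]
  have h1 : ∫ x in B, w x ^ 2 ≤ ∑ i ∈ I, ∫ x in cube r i, w x ^ 2 := by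
    rw [← integral_biUnion_finset I (fun i _ => measurableSet_cube r i)
      (fun i _ i' _ h => disjoint_cube r h) (fun i _ => w.integrable_sq.integrableOn)]
    exact setIntegral_mono_set w.integrable_sq.integrableOn
      (Eventually.of_forall fun x => sq_nonneg _) (LE.le.eventuallyLE hI)
  have h2 : ∑ i ∈ I, ∫ p in cube r i ×ˢ cube r i, gagliardoIntegrand s w w p ≤ ‖w‖ ^ 2 := by
    rw [← integral_biUnion_finset I
      (fun i _ => (measurableSet_cube r i).prod (measurableSet_cube r i))
      (fun i _ i' _ h => Set.disjoint_prod.2 (Or.inl (disjoint_cube r h)))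
      (fun i _ => (integrable_gagliardo w w).integrableOn)]
    exact (setIntegral_le_integral (integrable_gagliardo w w)
      (Eventually.of_forall (gagliardo_self_nonneg _))).trans w.integral_gagliardo_le
  have hpow : (0 : ℝ) ≤ (2 * r) ^ (3 + 2 * s) := by positivity
  calc b * ∫ x in B, w x ^ 2 ≤ b * ∑ i ∈ I, ∫ x in cube r i, w x ^ 2 :=
        mul_le_mul_of_nonneg_left h1 hb0.le
    _ = ∑ i ∈ I, b * ∫ x in cube r i, w x ^ 2 := Finset.mul_sum _ _ _
    _ ≤ ∑ i ∈ I, ((∫ x in cube r i, w x) ^ 2 + (2 * r) ^ (3 + 2 * s) *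
          ∫ p in cube r i ×ˢ cube r i, gagliardoIntegrand s w w p) := by
        refine Finset.sum_le_sum fun i _ => ?_
        refine le_trans (mul_le_mul_of_nonneg_right (le_volume_cube hr i)
          (integral_nonneg fun x => sq_nonneg _)) ?_
        exact measure_mul_setIntegral_sq_le hs w (measurableSet_cube r i) (volume_cube_ne_top hr i)
          fun x hx y hy => norm_sub_le_of_mem_cube hr hx hy
    _ ≤ _ := by
        rw [Finset.sum_add_distrib, ← Finset.mul_sum]
        gcongr

lemma tendsto_clm_of_weak {w : ℕ → HSpace s P ε}
    (hw : ∀ y, Tendsto (fun n => inner ℝ (w n) y) atTop (𝓝 0)) (ℓ : HSpace s P ε →L[ℝ] ℝ) :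
    Tendsto (fun n => ℓ (w n)) atTop (𝓝 0) := by
  refine (hw ((InnerProductSpace.toDual ℝ _).symm ℓ)).congr fun n => ?_
  rw [real_inner_comm, InnerProductSpace.toDual_symm_apply]

/-- The compact embedding of `H_ε` in `L²_loc`. -/
theorem tendsto_setIntegral_sq_of_weak (hs : 0 < s) {w : ℕ → HSpace s P ε} {R : ℝ}
    (hR : ∀ n, ‖w n‖ ≤ R) (hw : ∀ y, Tendsto (fun n => inner ℝ (w n) y) atTop (𝓝 0)) {B : Set E3}
    (hB : Bornology.IsBounded B) :
    Tendsto (fun n => ∫ x in B, w n x ^ 2) atTop (𝓝 0) := by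
  set ω := volume.real (Metric.ball (0 : E3) 1) with hω
  have hω0 : 0 < ω := volume_real_unitBall_pos
  -- The integral over a cube is a bounded linear functional on H_ε, so weak convergence applies to
  -- it.
  have hmean : ∀ r : ℝ, 0 < r → ∀ i, Tendsto (fun n => ∫ x in cube r i, w n x) atTop (𝓝 0) := by
    intro r hr i
    let e := indicatorConstLp 2 (measurableSet_cube r i) (volume_cube_ne_top hr i) (1 : ℝ)
    refine (tendsto_clm_of_weak hw ((innerSL ℝ e).comp (toL2CLM s P ε))).congr fun n => ?_
    exact L2.inner_indicatorConstLp_one _ _ _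
  have hsmall : Tendsto (fun r : ℝ => ((r / 2) ^ 3 * ω)⁻¹ * ((2 * r) ^ (3 + 2 * s) * R ^ 2))
      (𝓝[>] 0) (𝓝 0) := by
    -- The powers r^{-3} and r^{3+2s} leave r^{2s}; the constant 64 is 8·8, from (r/2)^{-3} and
    -- (2r)^3. The mesh r is fixed first to make this term small, and only then does n → ∞ remove
    -- the finitely many means.
    have h0 : Tendsto (fun r : ℝ => 64 / ω * R ^ 2 * (2 * r) ^ (2 * s)) (𝓝[>] 0) (𝓝 0) := by
      have hc : Continuous fun r : ℝ => 64 / ω * R ^ 2 * (2 * r) ^ (2 * s) := by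
        refine continuous_const.mul ((Real.continuous_rpow_const (by positivity)).comp ?_)
        fun_prop
      have := (hc.tendsto 0).mono_left (nhdsWithin_le_nhds (s := Ioi 0))
      simpa [Real.zero_rpow (by positivity : 2 * s ≠ 0)] using this
    refine h0.congr' ?_
    filter_upwards [self_mem_nhdsWithin] with r hr
    have hr' : 0 < r := hr
    rw [Real.rpow_add (by positivity), show (3 : ℝ) = ((3 : ℕ) : ℝ) by norm_num, Real.rpow_natCast]
    field_simp
    norm_num [mul_comm]
  rw [Metric.tendsto_atTop]
  intro η hη
  obtain ⟨r, hrη, hr⟩ := ((hsmall.eventually_lt_const (half_pos hη)).and self_mem_nhdsWithin).exists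
  have hr : 0 < r := hr
  obtain ⟨I, hI⟩ := exists_finset_cubes_cover hr hB
  have hsum : Tendsto (fun n => ((r / 2) ^ 3 * ω)⁻¹ * ∑ i ∈ I, (∫ x in cube r i, w n x) ^ 2) atTop
      (𝓝 0) := by
    have := (tendsto_finsetSum I fun i _ => (hmean r hr i).pow 2).const_mul ((r / 2) ^ 3 * ω)⁻¹
    simpa using this
  obtain ⟨N, hN⟩ := eventually_atTop.1 (hsum.eventually_lt_const (half_pos hη))
  refine ⟨N, fun n hn => ?_⟩
  have h := setIntegral_sq_le_of_cover hs (w n) hr hI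
  have h2 : ((r / 2) ^ 3 * ω)⁻¹ * ((2 * r) ^ (3 + 2 * s) * ‖w n‖ ^ 2) ≤
      ((r / 2) ^ 3 * ω)⁻¹ * ((2 * r) ^ (3 + 2 * s) * R ^ 2) := by
    have := hR n
    gcongr
  rw [mul_add] at h
  rw [dist_zero_right, Real.norm_of_nonneg (integral_nonneg fun x => sq_nonneg _)]
  linarith [hN n hn]

end HSpace

/-! ### Superposition operators on L² -/

section Superposition

variable {α : Type*} [MeasurableSpace α] {μ : Measure α}

lemma norm_toLp_sq {w : α → ℝ} (hw : MemLp w 2 μ) : ‖hw.toLp w‖ ^ 2 = ∫ x, w x ^ 2 ∂μ := by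
  rw [← real_inner_self_eq_norm_sq, L2.inner_def]
  refine integral_congr_ae ?_
  filter_upwards [hw.coeFn_toLp] with x hx
  simp [hx, sq]

lemma norm_Lp_sq (u : Lp ℝ 2 μ) : ‖u‖ ^ 2 = ∫ x, u x ^ 2 ∂μ := by
  rw [← norm_toLp_sq (Lp.memLp u), Lp.toLp_coeFn]

/-- The dominating function varies with n. Subtracting C|v_n| from |w_n| and taking the positive
part leaves a sequence dominated by the fixed function C|u|, to which dominated convergence applies;
the subtracted part vanishes in L². -/
lemma tendsto_integral_sq_of_dominated {u : α → ℝ} {v w : ℕ → α → ℝ} {C : ℝ} (hC : 0 ≤ C)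
    (hu : MemLp u 2 μ) (hv : ∀ n, MemLp (v n) 2 μ) (hw : ∀ n, AEStronglyMeasurable (w n) μ)
    (hvlim : Tendsto (fun n => ∫ x, v n x ^ 2 ∂μ) atTop (𝓝 0))
    (hb : ∀ n, ∀ᵐ x ∂μ, |w n x| ≤ C * (|u x| + |v n x|))
    (hlim : ∀ᵐ x ∂μ, Tendsto (fun n => w n x) atTop (𝓝 0)) :
    Tendsto (fun n => ∫ x, w n x ^ 2 ∂μ) atTop (𝓝 0) := by
  let z : ℕ → α → ℝ := fun n x => max (|w n x| - C * |v n x|) 0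
  have hzm : ∀ n, AEStronglyMeasurable (z n) μ := fun n => by
    refine AEStronglyMeasurable.sup ?_ aestronglyMeasurable_const
    exact (hw n).norm.sub ((hv n).1.norm.const_mul C)
  have hzb : ∀ n, ∀ᵐ x ∂μ, ‖z n x ^ 2‖ ≤ C ^ 2 * u x ^ 2 := fun n => by
    filter_upwards [hb n] with x hx
    have h1 : z n x ≤ C * |u x| := max_le (by linarith) (by positivity)
    have h0 : 0 ≤ z n x := le_max_right _ _
    rw [Real.norm_of_nonneg (sq_nonneg _), ← sq_abs (u x), ← mul_pow]
    exact pow_le_pow_left₀ h0 h1 2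
  have hzlim : Tendsto (fun n => ∫ x, z n x ^ 2 ∂μ) atTop (𝓝 0) := by
    have := tendsto_integral_of_dominated_convergence (f := fun _ => (0 : ℝ))
      (fun x => C ^ 2 * u x ^ 2) (fun n => (hzm n).pow 2) (hu.integrable_sq.const_mul _) hzb (by
        filter_upwards [hlim] with x hx
        have h1 : Tendsto (fun n => |w n x| ^ 2) atTop (𝓝 0) := by
          simpa using (hx.abs.pow 2)
        refine squeeze_zero (fun n => sq_nonneg _) (fun n => ?_) h1
        refine pow_le_pow_left₀ (le_max_right _ _) (max_le ?_ (abs_nonneg _)) 2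
        linarith [mul_nonneg hC (abs_nonneg (v n x))])
    simpa using this
  have hsum : Tendsto (fun n => 2 * ∫ x, z n x ^ 2 ∂μ + 2 * C ^ 2 * ∫ x, v n x ^ 2 ∂μ) atTop
      (𝓝 0) := by
    simpa using (hzlim.const_mul 2).add (hvlim.const_mul (2 * C ^ 2))
  refine squeeze_zero (fun n => integral_nonneg fun x => sq_nonneg _) (fun n => ?_) hsum
  have hzi : Integrable (fun x => z n x ^ 2) μ :=
    (hu.integrable_sq.const_mul (C ^ 2)).mono' ((hzm n).pow 2) (hzb n)
  rw [← integral_const_mul, ← integral_const_mul, ← integral_add (hzi.const_mul _)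
    ((hv n).integrable_sq.const_mul _)]
  refine integral_mono_of_nonneg (Eventually.of_forall fun x => sq_nonneg _)
    ((hzi.const_mul _).add ((hv n).integrable_sq.const_mul _)) (Eventually.of_forall fun x => ?_)
  have h1 : |w n x| ≤ z n x + C * |v n x| := by linarith [le_max_left (|w n x| - C * |v n x|) 0]
  have h2 := pow_le_pow_left₀ (abs_nonneg _) h1 2
  have h3 := sq_abs (v n x)
  have h4 := sq_abs (w n x)
  have h5 := sq_nonneg (z n x - C * |v n x|)
  simp only
  nlinarith

lemma memLp_comp₂ {h : ℝ → ℝ → ℝ} (hm : Measurable (Function.uncurry h)) {C : ℝ}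
    (hb : ∀ a b, |h a b| ≤ C * (|a| + |b - a|)) (u u' : Lp ℝ 2 μ) :
    MemLp (fun x => h (u x) (u' x)) 2 μ := by
  have hw : AEStronglyMeasurable (fun x => h (u x) (u' x)) μ :=
    (hm.comp ((Lp.stronglyMeasurable u).measurable.prodMk
      (Lp.stronglyMeasurable u').measurable)).aestronglyMeasurable
  have hg : MemLp (fun x => |u x| + |u' x - u x|) 2 μ :=
    (Lp.memLp u).abs.add ((Lp.memLp u').sub (Lp.memLp u)).abs
  refine hg.of_le_mul (c := C) hw (Eventually.of_forall fun x => ?_)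
  rw [Real.norm_eq_abs, Real.norm_of_nonneg (by positivity)]
  exact hb _ _

/-- The two-variable form serves twice: with h(a,b) = k(b) - k(a) for continuity of the
superposition operator, and with h a difference-quotient remainder for differentiability. Every
sequence has an almost everywhere convergent subsequence, which is enough for a limit. -/
lemma tendsto_integral_comp₂_sq {h : ℝ → ℝ → ℝ} (hm : Measurable (Function.uncurry h)) {C : ℝ}
    (hC : 0 ≤ C) (hb : ∀ a b, |h a b| ≤ C * (|a| + |b - a|))
    (hlim : ∀ a, Tendsto (h a) (𝓝 a) (𝓝 0)) (u : Lp ℝ 2 μ) :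
    Tendsto (fun u' : Lp ℝ 2 μ => ∫ x, h (u x) (u' x) ^ 2 ∂μ) (𝓝 u) (𝓝 0) := by
  refine tendsto_of_seq_tendsto fun w hw => tendsto_of_subseq_tendsto fun ns hns => ?_
  have hwn := hw.comp hns
  obtain ⟨ms, hms, hae⟩ := (tendstoInMeasure_of_tendsto_Lp hwn).exists_seq_tendsto_ae
  refine ⟨ms, ?_⟩
  have hsub := hwn.comp hms.tendsto_atTop
  refine tendsto_integral_sq_of_dominated (u := u) 
    (v := fun n => ((w (ns (ms n)) - u : Lp ℝ 2 μ) : α → ℝ)) hC (Lp.memLp u)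
    (fun n => Lp.memLp _) (fun n => (memLp_comp₂ hm hb u _).1) ?_ (fun n => ?_) ?_
  · have h0 : Tendsto (fun n => ‖w (ns (ms n)) - u‖ ^ 2) atTop (𝓝 0) := by
      simpa using (tendsto_iff_norm_sub_tendsto_zero.1 hsub).pow 2
    exact h0.congr fun n => norm_Lp_sq _
  · filter_upwards [Lp.coeFn_sub (w (ns (ms n))) u] with x hx
    rw [hx]
    exact hb _ _
  · filter_upwards [hae] with x hx
    exact (hlim (u x)).comp hx

variable {k : ℝ → ℝ} {C : ℝ}

lemma hasDerivAt_primitive (hk : Continuous k) (t : ℝ) :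
    HasDerivAt (fun t => ∫ τ in (0 : ℝ)..t, k τ) (k t) t :=
  intervalIntegral.integral_hasDerivAt_right (hk.intervalIntegrable _ _)
    hk.stronglyMeasurable.stronglyMeasurableAtFilter hk.continuousAt

lemma continuous_primitive (hk : Continuous k) : Continuous fun t => ∫ τ in (0 : ℝ)..t, k τ :=
  continuous_iff_continuousAt.2 fun t => (hasDerivAt_primitive hk t).continuousAt

lemma abs_primitive_sub_le (hk : Continuous k) (hC : 0 ≤ C) (hb : ∀ t, |k t| ≤ C * |t|)
    (a b : ℝ) : |(∫ τ in (0 : ℝ)..b, k τ) - ∫ τ in (0 : ℝ)..a, k τ| ≤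
      C * (|a| + |b - a|) * |b - a| := by
  rw [intervalIntegral.integral_interval_sub_left (hk.intervalIntegrable _ _)
    (hk.intervalIntegrable _ _), ← Real.norm_eq_abs]
  refine intervalIntegral.norm_integral_le_of_norm_le_const fun τ hτ => (hb τ).trans ?_
  refine mul_le_mul_of_nonneg_left ?_ hC
  have h : |τ - a| ≤ |b - a| := abs_sub_left_of_mem_uIcc (uIoc_subset_uIcc hτ)
  calc |τ| = |a + (τ - a)| := by ring_nf
    _ ≤ _ := (abs_add_le _ _).trans (by linarith)

/-- Quadratic functionals of superposition type are continuously differentiable on `L²`. -/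
lemma exists_hasFDerivAt_superposition (hk : Continuous k) (hC : 0 ≤ C)
    (hb : ∀ t, |k t| ≤ C * |t|) :
    ∃ N : Lp ℝ 2 μ → Lp ℝ 2 μ, Continuous N ∧ (∀ u, N u =ᵐ[μ] fun x => k (u x)) ∧
      ∀ u, HasFDerivAt (fun u : Lp ℝ 2 μ => ∫ x, (∫ τ in (0 : ℝ)..(u x), k τ) ∂μ)
        (innerSL ℝ (N u)) u := by
  set Kp : ℝ → ℝ := fun t => ∫ τ in (0 : ℝ)..t, k τ with hKp
  have hKc : Continuous Kp := continuous_primitive hk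
  have hNm : ∀ u : Lp ℝ 2 μ, MemLp (fun x => k (u x)) 2 μ := fun u =>
    (Lp.memLp u).of_le_mul (c := C)
      (hk.measurable.comp (Lp.stronglyMeasurable u).measurable).aestronglyMeasurable
      (Eventually.of_forall fun x => hb _)
  have hNe : ∀ u : Lp ℝ 2 μ, (hNm u).toLp _ =ᵐ[μ] fun x => k (u x) := fun u => (hNm u).coeFn_toLp
  have hKi : ∀ u : Lp ℝ 2 μ, Integrable (fun x => Kp (u x)) μ := fun u => by
    refine ((Lp.memLp u).integrable_sq.const_mul C).mono'
      (hKc.measurable.comp (Lp.stronglyMeasurable u).measurable).aestronglyMeasurable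
      (Eventually.of_forall fun x => ?_)
    have := abs_primitive_sub_le hk hC hb 0 (u x)
    simp only [intervalIntegral.integral_same, sub_zero, abs_zero, zero_add] at this
    rw [mul_assoc, abs_mul_abs_self, ← sq] at this
    exact this
  refine ⟨fun u => (hNm u).toLp _, ?_, hNe, fun u => ?_⟩
  · rw [continuous_iff_continuousAt]
    intro u
    have h := tendsto_integral_comp₂_sq (μ := μ) (h := fun a b => k b - k a) (C := 2 * C)
      (by have := hk.measurable; simp only [Function.uncurry_def]; fun_prop) (by positivity)
      (fun a b => by
        have h1 := hb a
        have h2 := hb b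
        have h3 := abs_sub (k b) (k a)
        have h4 : |b| ≤ |a| + |b - a| := by
          calc |b| = |a + (b - a)| := by ring_nf
            _ ≤ _ := abs_add_le _ _
        nlinarith [abs_nonneg (b - a), abs_nonneg a])
      (fun a => by simpa using (hk.tendsto a).sub_const (k a)) u
    have h2 : Tendsto (fun u' : Lp ℝ 2 μ => ‖(hNm u').toLp _ - (hNm u).toLp _‖ ^ 2) (𝓝 u)
        (𝓝 0) := by
      refine h.congr fun u' => ?_
      rw [← MemLp.toLp_sub, norm_toLp_sq]; rfl
    refine tendsto_iff_norm_sub_tendsto_zero.2 ?_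
    simpa [Real.sqrt_sq (norm_nonneg _)] using h2.sqrt
  -- The first-order remainder of the primitive divided by the increment, with value 0 on the
  -- diagonal since 0⁻¹ = 0. It has linear growth and tends to 0, so Cauchy–Schwarz bounds the
  -- remainder of the functional by ‖ρ(u,u')‖·‖u' - u‖ with ‖ρ(u,u')‖ → 0 in L².
  · let ρ : ℝ → ℝ → ℝ := fun a b => (b - a)⁻¹ * (Kp b - Kp a - (b - a) * k a)
    have hρ : ∀ a b, ρ a b * (b - a) = Kp b - Kp a - (b - a) * k a := by
      intro a b
      rcases eq_or_ne b a with rfl | hne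
      · simp
      · have := sub_ne_zero.2 hne
        simp only [ρ]; field_simp
    have hρm : Measurable (Function.uncurry ρ) := by
      have h1 := hKc.measurable
      have h2 := hk.measurable
      simp only [ρ, Function.uncurry_def]; fun_prop
    have hρb : ∀ a b, |ρ a b| ≤ 2 * C * (|a| + |b - a|) := by
      intro a b
      rcases eq_or_ne b a with rfl | hne
      · simp only [ρ, sub_self, inv_zero, zero_mul, abs_zero]; positivity
      · have h0 := abs_pos.2 (sub_ne_zero.2 hne)
        refine le_of_mul_le_mul_right ?_ h0
        rw [← abs_mul, hρ]
        have h1 := abs_primitive_sub_le hk hC hb a b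
        have h2 := abs_sub (Kp b - Kp a) ((b - a) * k a)
        rw [abs_mul] at h2
        have h3 : |b - a| * |k a| ≤ |b - a| * (C * |a|) := mul_le_mul_of_nonneg_left (hb a) h0.le
        have h4 : 0 ≤ C * |b - a| * |b - a| := by positivity
        simp only [hKp] at h2 ⊢
        nlinarith
    have hρl : ∀ a, Tendsto (ρ a) (𝓝 a) (𝓝 0) := by
      intro a
      refine squeeze_zero_norm (fun b => ?_) (hasDerivAt_iff_tendsto.1 (hasDerivAt_primitive hk a))
      simp only [ρ, norm_mul, norm_inv, smul_eq_mul]; rfl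
    have h := tendsto_integral_comp₂_sq hρm (by positivity) hρb hρl u
    have h2 : Tendsto (fun u' : Lp ℝ 2 μ => ‖(memLp_comp₂ hρm hρb u u').toLp _‖) (𝓝 u) (𝓝 0) := by
      have := h.sqrt
      simp only [Real.sqrt_zero] at this
      refine this.congr fun u' => ?_
      rw [← norm_toLp_sq (memLp_comp₂ hρm hρb u u'), Real.sqrt_sq (norm_nonneg _)]
    rw [hasFDerivAt_iff_tendsto]
    refine squeeze_zero (fun u' => by positivity) (fun u' => ?_) h2
    have e : (∫ x, Kp (u' x) ∂μ) - (∫ x, Kp (u x) ∂μ) - innerSL ℝ ((hNm u).toLp _) (u' - u) =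
        inner ℝ ((memLp_comp₂ hρm hρb u u').toLp _) (u' - u) := by
      have i3 : Integrable (fun x => inner ℝ ((hNm u).toLp _ x) ((u' - u) x)) μ :=
        L2.integrable_inner _ _
      rw [innerSL_apply_apply, L2.inner_def, L2.inner_def, ← integral_sub (hKi u') (hKi u),
        ← integral_sub (f := fun x => Kp (u' x) - Kp (u x)) ((hKi u').sub (hKi u)) i3]
      refine integral_congr_ae ?_
      filter_upwards [hNe u, (memLp_comp₂ hρm hρb u u').coeFn_toLp, Lp.coeFn_sub u' u]
        with x h1 h2 h3
      simp only [Pi.sub_apply] at h3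
      simp only [h1, h2, h3, RCLike.inner_apply, conj_trivial]
      linarith [hρ (u x) (u' x)]
    rw [e]
    rcases (norm_nonneg (u' - u)).eq_or_lt with h0 | h0
    · rw [← h0, inv_zero, zero_mul]; exact norm_nonneg _
    · rw [inv_mul_le_iff₀ h0]
      exact (norm_inner_le_norm _ _).trans_eq (mul_comm _ _)

end Superposition

/-! ### Subcritical growth and cutoffs -/

lemma rpow_sub_one_mul_le {p : ℝ} (hp : 1 < p) {a b : ℝ} (ha : 0 ≤ a) (hb : 0 ≤ b) :
    a ^ (p - 1) * b ≤ a ^ p + b ^ p := by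
  have e : ∀ c : ℝ, 0 ≤ c → c ^ (p - 1) * c = c ^ p := fun c hc => by
    nth_rewrite 2 [← Real.rpow_one c]
    rw [← Real.rpow_add_of_nonneg hc (by linarith) zero_le_one, sub_add_cancel]
  have hap : 0 ≤ a ^ p := by positivity
  have hbp : 0 ≤ b ^ p := by positivity
  rcases le_total a b with h | h
  · calc a ^ (p - 1) * b ≤ b ^ (p - 1) * b :=
          mul_le_mul_of_nonneg_right (Real.rpow_le_rpow ha h (by linarith)) hb
      _ ≤ _ := by rw [e b hb]; linarith
  · calc a ^ (p - 1) * b ≤ a ^ (p - 1) * a := mul_le_mul_of_nonneg_left h (by positivity)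
      _ ≤ _ := by rw [e a ha]; linarith

/-- Growth of order `q - 1` at infinity and order `1` at the origin. -/
def HasGrowth (f : ℝ → ℝ) (C q : ℝ) : Prop := ∀ t, |f t| ≤ C * (|t| + |t| ^ (q - 1))

/-- The truncation of the argument of `f` at level `n + 1`. -/
def cutoff (f : ℝ → ℝ) (n : ℕ) (t : ℝ) : ℝ := f (max (-(n + 1)) (min t (n + 1)))

section Cutoff

variable {f : ℝ → ℝ} {C q : ℝ}

lemma continuous_cutoff (hf : Continuous f) (n : ℕ) : Continuous (cutoff f n) := by
  unfold cutoff; fun_prop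

lemma abs_clamp_le {b : ℝ} (hb : 0 ≤ b) (t : ℝ) :
    |max (-b) (min t b)| ≤ |t| ∧ |max (-b) (min t b)| ≤ b := by
  refine ⟨?_, abs_le.2 ⟨le_max_left _ _, max_le (by linarith) (min_le_right _ _)⟩⟩
  rcases le_total 0 t with h | h
  · rw [abs_of_nonneg h, max_eq_right (by linarith [le_min h hb]), abs_of_nonneg (le_min h hb)]
    exact min_le_left _ _
  · rw [min_eq_left (h.trans hb), abs_of_nonpos h, abs_of_nonpos (max_le (by linarith) h)]
    linarith [le_max_right (-b) t]

lemma clamp_eq_self {b t : ℝ} (h : |t| ≤ b) : max (-b) (min t b) = t := by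
  rw [abs_le] at h
  rw [min_eq_left h.2, max_eq_right h.1]

/-- The clamped argument c satisfies c^{q-1} ≤ (n+1)^{q-2}·c, so each cutoff has linear growth and
falls under the L² theory. -/
lemma HasGrowth.abs_cutoff_le (hg : HasGrowth f C q) (hC : 0 ≤ C) (hq : 2 < q) (n : ℕ) (t : ℝ) :
    |cutoff f n t| ≤ C * (1 + ((n : ℝ) + 1) ^ (q - 2)) * |t| := by
  have hn : (0 : ℝ) ≤ n + 1 := by positivity
  obtain ⟨h1, h2⟩ := abs_clamp_le hn t
  refine (hg _).trans ?_
  set c := |max (-((n : ℝ) + 1)) (min t (n + 1))|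
  have hc : 0 ≤ c := abs_nonneg _
  have e : c ^ (q - 1) = c ^ (q - 2) * c := by
    nth_rewrite 3 [← Real.rpow_one c]
    rw [← Real.rpow_add_of_nonneg hc (by linarith) zero_le_one]; ring_nf
  have h3 : c ^ (q - 2) ≤ ((n : ℝ) + 1) ^ (q - 2) := Real.rpow_le_rpow hc h2 (by linarith)
  rw [e, mul_assoc]
  refine mul_le_mul_of_nonneg_left ?_ hC
  have h4 : 0 ≤ ((n : ℝ) + 1) ^ (q - 2) := by positivity
  nlinarith

lemma HasGrowth.abs_le_of_one_le (hg : HasGrowth f C q) (hC : 0 ≤ C) (hq : 2 < q) {b t : ℝ}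
    (hb : 1 ≤ b) (ht : |t| ≤ b) : |f t| ≤ 2 * C * b ^ (q - 1) := by
  have h1 : b ≤ b ^ (q - 1) := Real.self_le_rpow_of_one_le hb (by linarith)
  have h2 : |t| ^ (q - 1) ≤ b ^ (q - 1) := Real.rpow_le_rpow (abs_nonneg _) ht (by linarith)
  calc |f t| ≤ C * (|t| + |t| ^ (q - 1)) := hg t
    _ ≤ C * (b ^ (q - 1) + b ^ (q - 1)) := by gcongr; linarith
    _ = _ := by ring

/-- The rate at which cutoffs converge, relative to a higher power. -/
noncomputable def cutoffError (C q p : ℝ) (n : ℕ) : ℝ := 4 * C * ((n : ℝ) + 1) ^ (-(p - q))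

lemma cutoffError_nonneg (hC : 0 ≤ C) (p : ℝ) (n : ℕ) : 0 ≤ cutoffError C q p n := by
  unfold cutoffError; positivity

lemma tendsto_cutoffError (C : ℝ) {q p : ℝ} (hp : q < p) :
    Tendsto (cutoffError C q p) atTop (𝓝 0) := by
  have h := (tendsto_rpow_neg_atTop (sub_pos.2 hp)).comp
    (tendsto_atTop_add_const_right _ (1 : ℝ) tendsto_natCast_atTop_atTop)
  have h2 := h.const_mul (4 * C)
  rwa [mul_zero] at h2

/-- The two functions differ only where |t| > n+1, and there |t|^{q-1} = |t|^{-(p-q)}·|t|^{p-1}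
gains a negative power of n+1 at the price of the larger exponent p. -/
lemma HasGrowth.abs_sub_cutoff_le (hg : HasGrowth f C q) (hC : 0 ≤ C) (hq : 2 < q) {p : ℝ}
    (hp : q < p) (n : ℕ) (t : ℝ) :
    |f t - cutoff f n t| ≤ cutoffError C q p n * |t| ^ (p - 1) := by
  have hη := cutoffError_nonneg (q := q) hC p n
  have hn : (1 : ℝ) ≤ n + 1 := by linarith [(Nat.cast_nonneg n : (0 : ℝ) ≤ n)]
  rcases le_or_gt (|t|) (n + 1) with h | h
  · rw [cutoff, clamp_eq_self h, sub_self, abs_zero]; positivity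
  · have h1 := hg.abs_le_of_one_le hC hq (hn.trans h.le) le_rfl
    have h2 := hg.abs_le_of_one_le hC hq (hn.trans h.le) (abs_clamp_le (zero_le_one.trans hn) t).1
    have h3 : |f t - cutoff f n t| ≤ 4 * C * |t| ^ (q - 1) :=
      (abs_sub _ _).trans (by unfold cutoff; linarith)
    have ht : 0 < |t| := by linarith
    have h4 : |t| ^ (q - 1) = |t| ^ (-(p - q)) * |t| ^ (p - 1) := by
      rw [← Real.rpow_add ht]; ring_nf
    rw [h4, ← mul_assoc] at h3
    refine h3.trans (mul_le_mul_of_nonneg_right ?_ (by positivity))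
    refine mul_le_mul_of_nonneg_left ?_ (by positivity)
    exact Real.rpow_le_rpow_of_nonpos (by linarith) h.le (by linarith)

lemma abs_integral_le_rpow {g : ℝ → ℝ} {c p : ℝ} (hc : 0 ≤ c) (hp : 1 < p)
    (hb : ∀ t, |g t| ≤ c * |t| ^ (p - 1)) (t : ℝ) :
    |∫ τ in (0 : ℝ)..t, g τ| ≤ c * |t| ^ p := by
  have h : ‖∫ τ in (0 : ℝ)..t, g τ‖ ≤ c * |t| ^ (p - 1) * |t - 0| := by
    refine intervalIntegral.norm_integral_le_of_norm_le_const fun τ hτ => (hb τ).trans ?_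
    refine mul_le_mul_of_nonneg_left (Real.rpow_le_rpow (abs_nonneg _) ?_ (by linarith)) hc
    simpa using abs_sub_left_of_mem_uIcc (uIoc_subset_uIcc hτ)
  refine h.trans_eq ?_
  rw [sub_zero, mul_assoc]
  nth_rewrite 2 [← Real.rpow_one |t|]
  rw [← Real.rpow_add_of_nonneg (abs_nonneg _) (by linarith) zero_le_one, sub_add_cancel]

end Cutoff

/-! ### Differentiability of subcritical functionals on H_ε -/

namespace HSpace

variable {s : ℝ} {P : Potential} {ε : ℝ}

lemma integrable_mul (u v : HSpace s P ε) : Integrable (fun x => |u x| * |v x|) :=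
  u.memLp_two.abs.integrable_mul v.memLp_two.abs

lemma integrable_rpow (hs : 0 < s) (hs' : s < 1) {p : ℝ} (hp : 2 ≤ p)
    (hp' : p < 6 / (3 - 2 * s)) (u : HSpace s P ε) : Integrable (fun x => |u x| ^ p) := by
  obtain ⟨C, -, h⟩ := exists_integral_rpow_le (P := P) (ε := ε) hs hs' hp hp' ‖u‖
  exact (h u le_rfl).1

variable {f : ℝ → ℝ} {C q : ℝ}

lemma integrable_comp_mul (hs : 0 < s) (hs' : s < 1) (hf : Continuous f)
    (hg : HasGrowth f C q) (hC : 0 ≤ C) (hq : 2 < q) (hq' : q < 6 / (3 - 2 * s))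
    (u v : HSpace s P ε) : Integrable (fun x => f (u x) * v x) := by
  have hb : Integrable fun x => C * (|u x| * |v x| + (|u x| ^ q + |v x| ^ q)) :=
    ((integrable_mul u v).add ((u.integrable_rpow hs hs' hq.le hq').add
      (v.integrable_rpow hs hs' hq.le hq'))).const_mul C
  refine hb.mono' ((hf.measurable.comp u.measurable_coe).mul
    v.measurable_coe).aestronglyMeasurable (Eventually.of_forall fun x => ?_)
  rw [norm_mul, Real.norm_eq_abs, Real.norm_eq_abs]
  have h1 := mul_le_mul_of_nonneg_right (hg (u x)) (abs_nonneg (v x))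
  have h2 := rpow_sub_one_mul_le (p := q) (by linarith) (abs_nonneg (u x)) (abs_nonneg (v x))
  refine h1.trans ?_
  rw [mul_assoc, add_mul]
  gcongr

lemma integrable_primitive_comp (hs : 0 < s) (hs' : s < 1) (hf : Continuous f)
    (hg : HasGrowth f C q) (hC : 0 ≤ C) (hq : 2 < q) (hq' : q < 6 / (3 - 2 * s))
    (u : HSpace s P ε) : Integrable (fun x => ∫ τ in (0 : ℝ)..(u x), f τ) := by
  have hb : Integrable fun x => C * (u x ^ 2 + |u x| ^ q) :=
    (u.integrable_sq.add (u.integrable_rpow hs hs' hq.le hq')).const_mul C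
  refine hb.mono' ((continuous_primitive hf).measurable.comp
    u.measurable_coe).aestronglyMeasurable (Eventually.of_forall fun x => ?_)
  set t := u x
  have h : ‖∫ τ in (0 : ℝ)..t, f τ‖ ≤ C * (|t| + |t| ^ (q - 1)) * |t - 0| := by
    refine intervalIntegral.norm_integral_le_of_norm_le_const fun τ hτ => (hg τ).trans ?_
    have h1 : |τ| ≤ |t| := by simpa using abs_sub_left_of_mem_uIcc (uIoc_subset_uIcc hτ)
    have : |τ| ^ (q - 1) ≤ |t| ^ (q - 1) := Real.rpow_le_rpow (abs_nonneg _) h1 (by linarith)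
    gcongr
  refine h.trans_eq ?_
  have e : |t| ^ q = |t| ^ (q - 1) * |t| := by
    nth_rewrite 3 [← Real.rpow_one |t|]
    rw [← Real.rpow_add_of_nonneg (abs_nonneg _) (by linarith) zero_le_one, sub_add_cancel]
  rw [sub_zero, e, ← sq_abs t]
  ring

/-- The restriction of elements of `H_ε` to a set, as an element of `L²`. -/
noncomputable def restrictL2 (S : Set E3) :
    HSpace s P ε →L[ℝ] Lp ℝ 2 (volume.restrict S : Measure E3) :=
  (LpToLpRestrictCLM E3 ℝ ℝ volume 2 S).comp (toL2CLM s P ε)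

lemma restrictL2_coe (S : Set E3) (u : HSpace s P ε) :
    restrictL2 S u =ᵐ[volume.restrict S] u :=
  LpToLpRestrictCLM_coeFn ℝ S (toL2CLM s P ε u)

lemma exists_hasFDerivAt_of_linear_growth (S : Set E3) (hf : Continuous f) (hC : 0 ≤ C)
    (hb : ∀ t, |f t| ≤ C * |t|) :
    ∃ D : HSpace s P ε → (HSpace s P ε →L[ℝ] ℝ), Continuous D ∧
      (∀ u, HasFDerivAt (fun u : HSpace s P ε => ∫ x in S, ∫ τ in (0 : ℝ)..(u x), f τ) (D u) u) ∧
      ∀ u v, D u v = ∫ x in S, f (u x) * v x := by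
  obtain ⟨N, hN, hNe, hNd⟩ :=
    exists_hasFDerivAt_superposition (μ := (volume.restrict S : Measure E3)) hf hC hb
  refine ⟨fun u => (innerSL ℝ (N (restrictL2 S u))).comp (restrictL2 S), ?_, fun u => ?_,
    fun u v => ?_⟩
  · exact (((innerSL ℝ).continuous.comp hN).comp (restrictL2 S).continuous).clm_comp
      continuous_const
  · refine ((hNd (restrictL2 S u)).comp u (restrictL2 S).hasFDerivAt).congr_of_eventuallyEq
      (Eventually.of_forall fun w => integral_congr_ae ?_)
    filter_upwards [restrictL2_coe S w] with x hx
    rw [hx]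
  · rw [ContinuousLinearMap.comp_apply, innerSL_apply_apply, L2.inner_def]
    refine integral_congr_ae ?_
    filter_upwards [restrictL2_coe S u, restrictL2_coe S v, hNe (restrictL2 S u)] with x h1 h2 h3
    rw [h2, h3, h1]
    simp [mul_comm]

/-- Functionals of superposition type with subcritical growth are continuously differentiable
on `H_ε`. -/
theorem exists_hasFDerivAt_of_growth (hs : 0 < s) (hs' : s < 1) (S : Set E3)
    (hf : Continuous f) (hg : HasGrowth f C q) (hC : 0 ≤ C) (hq : 2 < q)
    (hq' : q < 6 / (3 - 2 * s)) :
    ∃ D : HSpace s P ε → (HSpace s P ε →L[ℝ] ℝ), Continuous D ∧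
      (∀ u, HasFDerivAt (fun u : HSpace s P ε => ∫ x in S, ∫ τ in (0 : ℝ)..(u x), f τ) (D u) u) ∧
      ∀ u v, D u v = ∫ x in S, f (u x) * v x := by
  -- The gap between q and the critical exponent is spent here: p-th powers are still bounded on
  -- balls of H_ε, and p > q makes the cutoff error tend to 0.
  obtain ⟨p, hqp, hp⟩ := exists_between hq'
  have hp2 : 2 ≤ p := by linarith
  choose D hDc hDd hDe using fun n : ℕ => exists_hasFDerivAt_of_linear_growth (s := s) (P := P) (ε := ε)
    S (continuous_cutoff hf n) (C := C * (1 + ((n : ℝ) + 1) ^ (q - 2))) (by positivity)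
    (hg.abs_cutoff_le hC hq n)
  set η := cutoffError C q p with hη
  have hη0 : ∀ n, 0 ≤ η n := cutoffError_nonneg hC p
  have hηlim : Tendsto η atTop (𝓝 0) := tendsto_cutoffError C hqp
  have hi : ∀ u v : HSpace s P ε, Integrable (fun x => f (u x) * v x) :=
    integrable_comp_mul hs hs' hf hg hC hq hq'
  have hip : ∀ u : HSpace s P ε, Integrable (fun x => |u x| ^ p) := integrable_rpow hs hs' hp2 hp
  obtain ⟨C₁, hC₁, hCb₁⟩ := exists_integral_rpow_le (P := P) (ε := ε) hs hs' hp2 hp 1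
  have hdiff : ∀ (n : ℕ) (u v : HSpace s P ε), ‖v‖ ≤ 1 →
      |(∫ x in S, f (u x) * v x) - D n u v| ≤ η n * ((∫ x, |u x| ^ p) + C₁) := by
    intro n u v hv
    have hin : Integrable (fun x => cutoff f n (u x) * v x) := by
      refine ((integrable_mul u v).const_mul (C * (1 + ((n : ℝ) + 1) ^ (q - 2)))).mono'
        (((continuous_cutoff hf n).measurable.comp u.measurable_coe).mul
          v.measurable_coe).aestronglyMeasurable (Eventually.of_forall fun x => ?_)
      rw [norm_mul, ← mul_assoc]
      exact mul_le_mul_of_nonneg_right (hg.abs_cutoff_le hC hq n _) (abs_nonneg _)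
    rw [hDe, ← integral_sub (hi u v).integrableOn hin.integrableOn, ← Real.norm_eq_abs]
    have hbi : Integrable fun x => η n * (|u x| ^ p + |v x| ^ p) :=
      ((hip u).add (hip v)).const_mul _
    calc ‖∫ x in S, (f (u x) * v x - cutoff f n (u x) * v x)‖
        ≤ ∫ x in S, η n * (|u x| ^ p + |v x| ^ p) := by
          refine norm_integral_le_of_norm_le hbi.integrableOn (Eventually.of_forall fun x => ?_)
          rw [← sub_mul, norm_mul]
          refine (mul_le_mul_of_nonneg_right (hg.abs_sub_cutoff_le hC hq hqp n (u x))
            (norm_nonneg _)).trans ?_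
          rw [mul_assoc]
          exact mul_le_mul_of_nonneg_left (rpow_sub_one_mul_le (by linarith) (abs_nonneg _)
            (abs_nonneg _)) (hη0 n)
      _ ≤ ∫ x, η n * (|u x| ^ p + |v x| ^ p) :=
          setIntegral_le_integral hbi (Eventually.of_forall fun x =>
            mul_nonneg (hη0 n) (by positivity))
      _ = η n * ((∫ x, |u x| ^ p) + ∫ x, |v x| ^ p) := by
          rw [integral_const_mul, integral_add (hip u) (hip v)]
      _ ≤ _ := by
          have := (hCb₁ v hv).2
          have := hη0 n
          gcongr
  let L : HSpace s P ε → (HSpace s P ε →ₗ[ℝ] ℝ) := fun u =>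
    { toFun := fun v => ∫ x in S, f (u x) * v x
      map_add' := fun v w => by
        rw [← integral_add (hi u v).integrableOn (hi u w).integrableOn]
        refine integral_congr_ae (ae_restrict_of_ae ?_)
        filter_upwards [coe_add v w] with x hx
        rw [hx, Pi.add_apply, mul_add]
      map_smul' := fun c v => by
        rw [RingHom.id_apply, smul_eq_mul, ← integral_const_mul]
        refine integral_congr_ae (ae_restrict_of_ae ?_)
        filter_upwards [coe_smul c v] with x hx
        rw [hx, Pi.smul_apply, smul_eq_mul]; ring }
  have hLb : ∀ u, ∃ c, ∀ v, ‖L u v‖ ≤ c * ‖v‖ := by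
    intro u
    -- On the unit ball the limiting functional is within a fixed distance of the bounded functional
    -- `D 0 u`, so it is bounded too.
    refine ⟨_, LinearMap.bound_of_ball_bound' one_pos
      (‖D 0 u‖ + η 0 * ((∫ x, |u x| ^ p) + C₁)) (L u) fun v hv => ?_⟩
    rw [mem_closedBall_zero_iff] at hv
    have h1 := hdiff 0 u v hv
    have h2 := (D 0 u).le_of_opNorm_le_of_le le_rfl hv
    rw [Real.norm_eq_abs] at h2 ⊢
    have h3 : |L u v| ≤ |L u v - D 0 u v| + |D 0 u v| := by
      simpa using abs_add_le (L u v - D 0 u v) (D 0 u v)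
    have h4 : |L u v - D 0 u v| ≤ η 0 * ((∫ x, |u x| ^ p) + C₁) := h1
    linarith
  let D' : HSpace s P ε → (HSpace s P ε →L[ℝ] ℝ) := fun u =>
    (L u).mkContinuousOfExistsBound (hLb u)
  have hD' : ∀ u v, D' u v = ∫ x in S, f (u x) * v x := fun u v => rfl
  -- Uniformity on balls yields both conclusions: continuity passes to the limit of the derivatives,
  -- and together with pointwise convergence of the functionals it makes the limit differentiable
  -- with derivative `D'`.
  have hunif : ∀ R, TendstoUniformlyOn D D' atTop (Metric.ball 0 R) := by
    intro R
    obtain ⟨C₂, hC₂, hCb₂⟩ := exists_integral_rpow_le (P := P) (ε := ε) hs hs' hp2 hp R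
    have hlim : Tendsto (fun n => η n * (C₂ + C₁)) atTop (𝓝 0) := by
      simpa using hηlim.mul_const (C₂ + C₁)
    refine (Metric.tendstoUniformlyOn_iff (F := D) (f := D')).2 fun e he => ?_
    filter_upwards [hlim.eventually_lt_const he] with n hn u hu
    refine (dist_eq_norm (D' u) (D n u)).trans_lt (lt_of_le_of_lt ?_ hn)
    have h0 := hη0 n
    refine ContinuousLinearMap.opNorm_le_of_unit_norm (by positivity) fun v hv => ?_
    refine (hdiff n u v hv.le).trans ?_
    have := (hCb₂ u (mem_ball_zero_iff.1 hu).le).2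
    gcongr
  refine ⟨D', ?_, fun u => ?_, hD'⟩
  · rw [continuous_iff_continuousAt]
    intro u
    have hmem : Metric.ball (0 : HSpace s P ε) (‖u‖ + 1) ∈ 𝓝 u :=
      Metric.isOpen_ball.mem_nhds (by simp)
    exact ((hunif (‖u‖ + 1)).continuousOn
      (Eventually.of_forall fun n => (hDc n).continuousOn).frequently).continuousAt hmem
  · refine hasFDerivAt_of_tendstoUniformlyOn Metric.isOpen_ball (hunif (‖u‖ + 1))
      (fun n w _ => hDd n w) (fun w _ => ?_) (by simp)
    have hw := integrable_primitive_comp hs hs' hf hg hC hq hq' w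
    rw [tendsto_iff_norm_sub_tendsto_zero]
    have hlim : Tendsto (fun n => η n * ∫ x, |w x| ^ p) atTop (𝓝 0) := by
      simpa using hηlim.mul_const _
    refine squeeze_zero (fun n => norm_nonneg _) (fun n => ?_) hlim
    have hcg : HasGrowth (cutoff f n) (C * (1 + ((n : ℝ) + 1) ^ (q - 2))) q := fun t =>
      (hg.abs_cutoff_le hC hq n t).trans (mul_le_mul_of_nonneg_left
        (by linarith [Real.rpow_nonneg (abs_nonneg t) (q - 1)]) (by positivity))
    have hwn := integrable_primitive_comp hs hs' (continuous_cutoff hf n) hcg (by positivity)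
      hq hq' w
    rw [norm_sub_rev, ← integral_sub hw.integrableOn hwn.integrableOn]
    have hbi := (hip w).const_mul (η n)
    calc _ ≤ ∫ x in S, η n * |w x| ^ p := by
          refine norm_integral_le_of_norm_le hbi.integrableOn (Eventually.of_forall fun x => ?_)
          rw [← intervalIntegral.integral_sub (hf.intervalIntegrable _ _)
            ((continuous_cutoff hf n).intervalIntegrable _ _)]
          exact abs_integral_le_rpow (hη0 n) (by linarith)
            (hg.abs_sub_cutoff_le hC hq hqp n) (w x)
      _ ≤ ∫ x, η n * |w x| ^ p :=
          setIntegral_le_integral hbi (Eventually.of_forall fun x =>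
            mul_nonneg (hη0 n) (by positivity))
      _ = _ := integral_const_mul _ _

end HSpace

/-! ### The Kirchhoff function -/

namespace IsKirchhoff

variable {M : ℝ → ℝ} {m₀ : ℝ}

/-- M is controlled only on [0,∞). Freezing it at M(0) on the negative axis gives a continuous
function on ℝ, so that its primitive is differentiable also at u = 0. -/
lemma continuous_extend (hM : IsKirchhoff M m₀) : Continuous fun t => M (max t 0) :=
  hM.continuousOn.comp_continuous (by fun_prop) fun t => le_max_right t 0

lemma integral_extend (M : ℝ → ℝ) {t : ℝ} (ht : 0 ≤ t) :
    ∫ τ in (0 : ℝ)..t, M (max τ 0) = ∫ τ in (0 : ℝ)..t, M τ := by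
  refine intervalIntegral.integral_congr fun τ hτ => ?_
  rw [uIcc_of_le ht] at hτ
  simp only [max_eq_left hτ.1]

/-- The quotient condition says that (M(τ) - m₀)/τ is nonincreasing. On [0,t] the graph of M
therefore lies above the segment from (0,m₀) to (t,M(t)), and the trapezoid under it has the stated
area. -/
lemma le_integral (hM : IsKirchhoff M m₀) {t : ℝ} (ht : 0 ≤ t) :
    1 / 2 * (M t + m₀) * t ≤ ∫ τ in (0 : ℝ)..t, M τ := by
  rcases ht.eq_or_lt with rfl | ht
  · simp
  set c := (M t - m₀) / t
  have hc : c * t = M t - m₀ := div_mul_cancel₀ _ ht.ne'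
  have hle : ∫ τ in (0 : ℝ)..t, (m₀ + c * τ) ≤ ∫ τ in (0 : ℝ)..t, M τ := by
    refine intervalIntegral.integral_mono_on ht.le
      ((by fun_prop : Continuous fun τ => m₀ + c * τ).intervalIntegrable _ _)
      (ContinuousOn.intervalIntegrable (hM.continuousOn.mono fun τ hτ => ?_)) fun τ hτ => ?_
    · rw [uIcc_of_le ht.le] at hτ; exact hτ.1
    · rcases hτ.1.eq_or_lt with rfl | h0
      · simpa using hM.lower 0 le_rfl
      · have h := hM.quotient t τ h0 hτ.2
        have h2 := mul_le_mul_of_nonneg_right h (mul_pos ht h0).le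
        have e1 : (M t / t - M τ / τ) * (t * τ) = M t * τ - M τ * t := by field_simp
        have e2 : m₀ * (1 / t - 1 / τ) * (t * τ) = m₀ * (τ - t) := by field_simp
        rw [e1, e2] at h2
        refine le_of_mul_le_mul_right ?_ ht
        nlinarith
  refine le_trans (le_of_eq ?_) hle
  rw [intervalIntegral.integral_add (by simp) ((continuous_const_mul c).intervalIntegrable _ _),
    intervalIntegral.integral_const_mul, integral_id, intervalIntegral.integral_const]
  simp only [smul_eq_mul, sub_zero]
  linear_combination -(t / 2) * hc

end IsKirchhoff

/-! ### The nonlinearity and its truncation -/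

namespace IsNonlinearity

variable {s : ℝ} {f : ℝ → ℝ}

lemma eq_zero_of_nonpos (hf : IsNonlinearity s f) {t : ℝ} (ht : t ≤ 0) : f t = 0 := by
  rcases ht.lt_or_eq with h | rfl
  · exact hf.zero_of_neg t h
  · have h1 : Tendsto f (𝓝[<] 0) (𝓝 (f 0)) := (hf.continuous.tendsto 0).mono_left nhdsWithin_le_nhds
    have h2 : Tendsto f (𝓝[<] 0) (𝓝 0) :=
      tendsto_const_nhds.congr' (eventually_nhdsWithin_of_forall fun t ht =>
        (hf.zero_of_neg t ht).symm)
    exact tendsto_nhds_unique h1 h2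

lemma pos (hf : IsNonlinearity s f) {t : ℝ} (ht : 0 < t) : 0 < f t := by
  obtain ⟨θ, -, -, h⟩ := hf.ambrosettiRabinowitz
  exact pos_of_mul_pos_left ((h t ht).1.trans_le (h t ht).2) ht.le

lemma four_mul_primitive_le (hf : IsNonlinearity s f) (t : ℝ) :
    0 ≤ f t * t - 4 * ∫ τ in (0 : ℝ)..t, f τ := by
  rcases le_or_gt t 0 with ht | ht
  · have h0 : ∫ τ in (0 : ℝ)..t, f τ = ∫ τ in (0 : ℝ)..t, (0 : ℝ) := by
      refine intervalIntegral.integral_congr fun τ hτ => ?_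
      rw [uIcc_of_ge ht] at hτ
      exact hf.eq_zero_of_nonpos hτ.2
    rw [h0, hf.eq_zero_of_nonpos ht]; simp
  · obtain ⟨θ, hθ, -, h⟩ := hf.ambrosettiRabinowitz
    have h1 := (h t ht).1
    have h2 : 0 < ∫ τ in (0 : ℝ)..t, f τ := pos_of_mul_pos_right h1 (by linarith)
    nlinarith [(h t ht).2]

/-- Near 0 the bound f(t) < t³ ≤ t is used, at infinity f(t) < t^{q-1}, and on the compact range
between them continuity bounds f by a multiple of t. -/
lemma exists_hasGrowth (hf : IsNonlinearity s f) :
    ∃ C q : ℝ, 0 ≤ C ∧ 2 < q ∧ q < 6 / (3 - 2 * s) ∧ HasGrowth f C q := by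
  obtain ⟨q, hq, hq', hlim⟩ := hf.at_top
  obtain ⟨T, hT⟩ := eventually_atTop.1 (hlim.eventually_lt_const one_pos)
  obtain ⟨r, hr, hr'⟩ := mem_nhdsGT_iff_exists_Ioo_subset.1
    (hf.at_zero.eventually_lt_const one_pos)
  have hr0 : 0 < r := hr
  obtain ⟨B, hB⟩ := isCompact_Icc.exists_bound_of_continuousOn (s := Icc 0 T)
    hf.continuous.continuousOn
  -- The cap at 1 is what allows t³ ≤ t near the origin.
  set r' := min r 1
  have hr'0 : 0 < r' := lt_min hr0 one_pos
  refine ⟨1 + |B| / r', q, by positivity, by linarith, hq', fun t => ?_⟩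
  have hBr : 0 ≤ |B| / r' := by positivity
  have ha := abs_nonneg t
  have hp : 0 ≤ |t| ^ (q - 1) := by positivity
  rcases le_or_gt t 0 with ht | ht
  · rw [hf.eq_zero_of_nonpos ht, abs_zero]; positivity
  rw [abs_of_pos ht] at ha hp ⊢
  rw [abs_of_pos (hf.pos ht)]
  rcases le_or_gt T t with h1 | h1
  · have h := hT t h1
    rw [div_lt_one (by positivity)] at h
    nlinarith
  rcases lt_or_ge t r' with h2 | h2
  · have h : f t / t ^ 3 < 1 := hr' ⟨ht, h2.trans_le (min_le_left _ _)⟩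
    rw [div_lt_one (by positivity)] at h
    have h3 : t ≤ 1 := h2.le.trans (min_le_right _ _)
    have h4 : t ^ 3 ≤ t := by
      calc t ^ 3 ≤ t ^ 1 := pow_le_pow_of_le_one ht.le h3 (by norm_num)
        _ = t := pow_one t
    nlinarith
  · have h := hB t ⟨ht.le, h1.le⟩
    rw [Real.norm_of_nonneg (hf.pos ht).le] at h
    have h3 : |B| ≤ |B| / r' * t := by
      rw [div_mul_eq_mul_div, le_div_iff₀ hr'0]
      exact mul_le_mul_of_nonneg_left h2 (abs_nonneg _)
    nlinarith [le_abs_self B]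

variable {V₀ K a : ℝ}

lemma continuous_truncated (hf : IsNonlinearity s f) (hfa : f a = V₀ / K * a) :
    Continuous (truncated f V₀ K a) :=
  hf.continuous.if_le (continuous_const_mul _) continuous_id continuous_const
    fun t ht => by rw [show t = a from ht]; exact hfa

lemma truncated_eq_zero (hf : IsNonlinearity s f) (ha : 0 < a) {t : ℝ} (ht : t ≤ 0) :
    truncated f V₀ K a t = 0 := by
  rw [truncated, if_pos (ht.trans ha.le), hf.eq_zero_of_nonpos ht]

lemma truncated_nonneg (hf : IsNonlinearity s f) (hVK : 0 ≤ V₀ / K) {t : ℝ} (ht : 0 < t) :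
    0 ≤ truncated f V₀ K a t := by
  unfold truncated
  split_ifs
  · exact (hf.pos ht).le
  · positivity

/-- Below a, monotonicity of f(t)/t³ gives f(t)/t ≤ (f(a)/a)(t/a)² ≤ V₀/K, by the choice of a. -/
lemma truncated_le (hf : IsNonlinearity s f) (ha : 0 < a) (hfa : f a = V₀ / K * a)
    (hVK : 0 ≤ V₀ / K) {t : ℝ} (ht : 0 ≤ t) : truncated f V₀ K a t ≤ V₀ / K * t := by
  rcases ht.eq_or_lt with rfl | ht
  · rw [hf.truncated_eq_zero ha le_rfl, mul_zero]
  unfold truncated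
  split_ifs with h
  · have hm : f t / t ^ 3 ≤ f a / a ^ 3 := hf.mono ht ha h
    rw [div_le_div_iff₀ (by positivity) (by positivity), hfa] at hm
    have h2 : t ^ 2 ≤ a ^ 2 := pow_le_pow_left₀ ht.le h 2
    refine le_of_mul_le_mul_right (hm.trans ?_) (pow_pos ha 3)
    calc V₀ / K * a * t ^ 3 = V₀ / K * (a * t) * t ^ 2 := by ring
      _ ≤ V₀ / K * (a * t) * a ^ 2 := mul_le_mul_of_nonneg_left h2 (by positivity)
      _ = _ := by ring
  · exact le_rfl

lemma abs_truncated_le (hf : IsNonlinearity s f) (ha : 0 < a) (hfa : f a = V₀ / K * a)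
    (hVK : 0 ≤ V₀ / K) (t : ℝ) : |truncated f V₀ K a t| ≤ V₀ / K * |t| := by
  rcases le_or_gt t 0 with ht | ht
  · rw [hf.truncated_eq_zero ha ht, abs_zero]; positivity
  · rw [abs_of_nonneg (hf.truncated_nonneg hVK ht), abs_of_pos ht]
    exact hf.truncated_le ha hfa hVK ht.le

/-- Up to a, this is the Ambrosetti–Rabinowitz estimate for f. Beyond a, the product term equals
(V₀/K)t² and the primitive is at most (V₀/2K)t², so the deficit is at most 2(V₀/K)t² - (V₀/K)t². -/
lemma truncated_four_mul_primitive_le (hf : IsNonlinearity s f) (ha : 0 < a)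
    (hfa : f a = V₀ / K * a) (hVK : 0 ≤ V₀ / K) (t : ℝ) :
    -(V₀ / K * t ^ 2) ≤
      truncated f V₀ K a t * t - 4 * ∫ τ in (0 : ℝ)..t, truncated f V₀ K a τ := by
  rcases le_or_gt t a with ht | ht
  · have h0 : ∫ τ in (0 : ℝ)..t, truncated f V₀ K a τ = ∫ τ in (0 : ℝ)..t, f τ := by
      refine intervalIntegral.integral_congr fun τ hτ => ?_
      exact if_pos (hτ.2.trans (max_le ha.le ht))
    rw [h0, truncated, if_pos ht]
    have h1 := hf.four_mul_primitive_le t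
    have h2 : 0 ≤ V₀ / K * t ^ 2 := by positivity
    linarith
  · have h0 : ∫ τ in (0 : ℝ)..t, truncated f V₀ K a τ ≤ ∫ τ in (0 : ℝ)..t, V₀ / K * τ :=
      intervalIntegral.integral_mono_on (ha.trans ht).le
        ((hf.continuous_truncated hfa).intervalIntegrable _ _)
        ((continuous_const_mul _).intervalIntegrable _ _)
        fun τ hτ => hf.truncated_le ha hfa hVK hτ.1
    rw [intervalIntegral.integral_const_mul, integral_id] at h0
    rw [truncated, if_neg ht.not_ge]
    linarith

end IsNonlinearity

lemma penalizedPrimitive_of_mem {f : ℝ → ℝ} {V₀ K a : ℝ} {Ω : Set E3} {x : E3} (hx : x ∈ Ω)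
    (t : ℝ) : penalizedPrimitive f V₀ K a Ω x t = ∫ τ in (0 : ℝ)..t, f τ := by
  simp [penalizedPrimitive, penalized, hx]

lemma penalizedPrimitive_of_notMem {f : ℝ → ℝ} {V₀ K a : ℝ} {Ω : Set E3} {x : E3} (hx : x ∉ Ω)
    (t : ℝ) : penalizedPrimitive f V₀ K a Ω x t =
      ∫ τ in (0 : ℝ)..t, truncated f V₀ K a τ := by
  simp [penalizedPrimitive, penalized, hx]

/-! ### Convergence of integrals along weakly convergent sequences -/

lemma integral_abs_mul_le {α : Type*} [MeasurableSpace α] {μ : Measure α} {u v : α → ℝ}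
    (hu : MemLp u 2 μ) (hv : MemLp v 2 μ) :
    ∫ x, |u x| * |v x| ∂μ ≤ √(∫ x, u x ^ 2 ∂μ) * √(∫ x, v x ^ 2 ∂μ) := by
  have hu' : MemLp (fun x => |u x|) 2 μ := hu.abs
  have hv' : MemLp (fun x => |v x|) 2 μ := hv.abs
  have h := real_inner_le_norm (hu'.toLp _) (hv'.toLp _)
  have e : inner ℝ (hu'.toLp _) (hv'.toLp _) = ∫ x, |u x| * |v x| ∂μ := by
    rw [L2.inner_def]
    refine integral_congr_ae ?_
    filter_upwards [hu'.coeFn_toLp, hv'.coeFn_toLp] with x h1 h2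
    simp [h1, h2, mul_comm]
  have n : ∀ {w : α → ℝ} (hw : MemLp (fun x => |w x|) 2 μ),
      ‖hw.toLp _‖ = √(∫ x, w x ^ 2 ∂μ) := fun hw => by
    rw [← Real.sqrt_sq (norm_nonneg _), norm_toLp_sq]
    simp only [sq_abs]
  rwa [e, n, n] at h

namespace HSpace

variable {s : ℝ} {P : Potential} {ε : ℝ}

lemma sqrt_integral_sq_le {u : HSpace s P ε} {R : ℝ} (hR : ‖u‖ ≤ R) :
    √(∫ x, u x ^ 2) ≤ √(R ^ 2 / P.V₀) := by
  refine Real.sqrt_le_sqrt ?_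
  rw [le_div_iff₀ P.V₀_pos, mul_comm]
  exact u.integral_sq_le.trans (pow_le_pow_left₀ (norm_nonneg _) hR 2)

lemma setIntegral_sq_le (u : HSpace s P ε) (B : Set E3) :
    ∫ x in B, u x ^ 2 ≤ ∫ x, u x ^ 2 :=
  setIntegral_le_integral u.integrable_sq (Eventually.of_forall fun _ => sq_nonneg _)

lemma tendsto_setIntegral_mul_of_weak (hs : 0 < s) {u w : ℕ → HSpace s P ε} {R : ℝ}
    (hu : ∀ n, ‖u n‖ ≤ R) (hR : ∀ n, ‖w n‖ ≤ R)
    (hw : ∀ y, Tendsto (fun n => inner ℝ (w n) y) atTop (𝓝 0)) {B : Set E3}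
    (hB : Bornology.IsBounded B) :
    Tendsto (fun n => ∫ x in B, |u n x| * |w n x|) atTop (𝓝 0) := by
  have h := ((tendsto_setIntegral_sq_of_weak hs hR hw hB).sqrt).const_mul √(R ^ 2 / P.V₀)
  rw [Real.sqrt_zero, mul_zero] at h
  refine squeeze_zero (fun n => integral_nonneg fun x => by positivity) (fun n => ?_) h
  refine (integral_abs_mul_le ((u n).memLp_two.restrict B) ((w n).memLp_two.restrict B)).trans ?_
  refine mul_le_mul_of_nonneg_right ?_ (Real.sqrt_nonneg _)
  exact (Real.sqrt_le_sqrt ((u n).setIntegral_sq_le B)).trans (sqrt_integral_sq_le (hu n))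

/-- With one factor fixed the domain may be all of ℝ³: the L² tail of u is small outside a large
ball, uniformly in n, and local compactness handles the ball. -/
lemma tendsto_integral_mul_of_weak (hs : 0 < s) (u : HSpace s P ε) {w : ℕ → HSpace s P ε} {R : ℝ}
    (hR : ∀ n, ‖w n‖ ≤ R) (hw : ∀ y, Tendsto (fun n => inner ℝ (w n) y) atTop (𝓝 0)) :
    Tendsto (fun n => ∫ x, |u x| * |w n x|) atTop (𝓝 0) := by
  have htail : Tendsto (fun j : ℕ => √(∫ x in (Metric.ball (0 : E3) j)ᶜ, u x ^ 2) *
      √(R ^ 2 / P.V₀)) atTop (𝓝 0) := by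
    have h := tendsto_setIntegral_of_antitone (μ := volume) (f := fun x => u x ^ 2)
      (s := fun j : ℕ => (Metric.ball (0 : E3) j)ᶜ) (fun j => measurableSet_ball.compl)
      (fun i j hij => compl_subset_compl.2 (Metric.ball_subset_ball (Nat.cast_le.2 hij)))
      ⟨0, u.integrable_sq.integrableOn⟩
    have he : ⋂ j : ℕ, (Metric.ball (0 : E3) j)ᶜ = ∅ := by
      rw [← compl_iUnion, Metric.iUnion_ball_nat, compl_univ]
    rw [he, setIntegral_empty] at h
    simpa using h.sqrt.mul_const √(R ^ 2 / P.V₀)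
  rw [Metric.tendsto_atTop]
  intro e he
  obtain ⟨j, hj⟩ := (htail.eventually_lt_const (half_pos he)).exists
  have hloc := tendsto_setIntegral_mul_of_weak hs (u := fun _ => u) (R := max R ‖u‖)
    (fun _ => le_max_right _ _) (fun n => (hR n).trans (le_max_left _ _)) hw
    (Metric.isBounded_ball (x := (0 : E3)) (r := j))
  obtain ⟨N, hN⟩ := eventually_atTop.1 (hloc.eventually_lt_const (half_pos he))
  refine ⟨N, fun n hn => ?_⟩
  rw [dist_zero_right, Real.norm_of_nonneg (integral_nonneg fun x => by positivity),
    ← integral_add_compl (measurableSet_ball (x := (0 : E3)) (ε := j)) (integrable_mul u (w n))]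
  have h2 : ∫ x in (Metric.ball (0 : E3) j)ᶜ, |u x| * |w n x| ≤
      √(∫ x in (Metric.ball (0 : E3) j)ᶜ, u x ^ 2) * √(R ^ 2 / P.V₀) := by
    refine (integral_abs_mul_le (u.memLp_two.restrict _) ((w n).memLp_two.restrict _)).trans ?_
    refine mul_le_mul_of_nonneg_left ?_ (Real.sqrt_nonneg _)
    exact (Real.sqrt_le_sqrt ((w n).setIntegral_sq_le _)).trans (sqrt_integral_sq_le (hR n))
  linarith [hN n hn]

/-- Split f into a cutoff of linear growth, handled by L² compactness on B, and an error controlled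
by p-th powers uniformly in n. The cutoff level is chosen before n. -/
lemma tendsto_setIntegral_comp_mul_of_weak (hs : 0 < s) (hs' : s < 1) {f : ℝ → ℝ} {C q : ℝ}
    (hg : HasGrowth f C q) (hC : 0 ≤ C) (hq : 2 < q)
    (hq' : q < 6 / (3 - 2 * s)) {u w : ℕ → HSpace s P ε} {R : ℝ}
    (hu : ∀ n, ‖u n‖ ≤ R) (hR : ∀ n, ‖w n‖ ≤ R)
    (hw : ∀ y, Tendsto (fun n => inner ℝ (w n) y) atTop (𝓝 0)) {B : Set E3}
    (hB : Bornology.IsBounded B) :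
    Tendsto (fun n => ∫ x in B, f (u n x) * w n x) atTop (𝓝 0) := by
  obtain ⟨p, hqp, hp⟩ := exists_between hq'
  have hp2 : 2 ≤ p := by linarith
  obtain ⟨A, hA, hAb⟩ := exists_integral_rpow_le (P := P) (ε := ε) hs hs' hp2 hp R
  have hη : Tendsto (fun m => cutoffError C q p m * (A + A)) atTop (𝓝 0) := by
    simpa using (tendsto_cutoffError C hqp).mul_const (A + A)
  rw [Metric.tendsto_atTop]
  intro e he
  obtain ⟨m, hm⟩ := (hη.eventually_lt_const (half_pos he)).exists
  set c := C * (1 + ((m : ℝ) + 1) ^ (q - 2))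
  have hη0 := cutoffError_nonneg (q := q) hC p m
  have hloc := (tendsto_setIntegral_mul_of_weak hs hu hR hw hB).const_mul c
  rw [mul_zero] at hloc
  obtain ⟨N, hN⟩ := eventually_atTop.1 (hloc.eventually_lt_const (half_pos he))
  refine ⟨N, fun n hn => ?_⟩
  obtain ⟨iu, hu1⟩ := hAb (u n) (hu n)
  obtain ⟨iw, hw1⟩ := hAb (w n) (hR n)
  have i1 : Integrable fun x => c * (|u n x| * |w n x|) := (integrable_mul _ _).const_mul _
  have i2 : Integrable fun x => cutoffError C q p m * (|u n x| ^ p + |w n x| ^ p) :=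
    (iu.add iw).const_mul _
  rw [dist_zero_right]
  calc ‖∫ x in B, f (u n x) * w n x‖
      ≤ ∫ x in B, (c * (|u n x| * |w n x|) +
          cutoffError C q p m * (|u n x| ^ p + |w n x| ^ p)) := by
        refine norm_integral_le_of_norm_le (i1.add i2).integrableOn
          (Eventually.of_forall fun x => ?_)
        have h1 := hg.abs_sub_cutoff_le hC hq hqp m (u n x)
        have h2 := hg.abs_cutoff_le hC hq m (u n x)
        have h3 : |f (u n x)| ≤ c * |u n x| + cutoffError C q p m * |u n x| ^ (p - 1) := by
          have := abs_add_le (f (u n x) - cutoff f m (u n x)) (cutoff f m (u n x))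
          rw [sub_add_cancel] at this
          linarith
        have h4 := rpow_sub_one_mul_le (p := p) (by linarith) (abs_nonneg (u n x))
          (abs_nonneg (w n x))
        rw [norm_mul, Real.norm_eq_abs, Real.norm_eq_abs]
        refine (mul_le_mul_of_nonneg_right h3 (abs_nonneg _)).trans ?_
        have h5 := mul_le_mul_of_nonneg_left h4 hη0
        linarith
    _ = c * (∫ x in B, |u n x| * |w n x|) +
          ∫ x in B, cutoffError C q p m * (|u n x| ^ p + |w n x| ^ p) := by
        rw [integral_add i1.integrableOn i2.integrableOn, integral_const_mul]
    _ ≤ c * (∫ x in B, |u n x| * |w n x|) + cutoffError C q p m * (A + A) := by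
        refine add_le_add_right ((setIntegral_le_integral i2 (Eventually.of_forall fun x =>
          mul_nonneg hη0 (by positivity))).trans ?_) _
        rw [integral_const_mul, integral_add iu iw]
        gcongr
    _ < e := by linarith [hN n hn]

end HSpace

/-! ### The energy -/

namespace HSpace

variable {s : ℝ} {P : Potential} {ε : ℝ} {M f : ℝ → ℝ} {m₀ K a : ℝ} {Ω : Set E3}

lemma measurableSet_preimage_smul (hΩ : IsOpen Ω) (ε : ℝ) : MeasurableSet {x : E3 | ε • x ∈ Ω} :=
  (hΩ.preimage (continuous_const_smul ε)).measurableSet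

lemma penalizedPrimitive_comp_eq_piecewise (ε : ℝ) (u : E3 → ℝ)
    [DecidablePred (· ∈ {x : E3 | ε • x ∈ Ω})] :
    (fun x : E3 => penalizedPrimitive f P.V₀ K a Ω (ε • x) (u x)) =
      Set.piecewise {x : E3 | ε • x ∈ Ω} (fun x => ∫ τ in (0 : ℝ)..(u x), f τ)
        (fun x => ∫ τ in (0 : ℝ)..(u x), truncated f P.V₀ K a τ) := by
  funext x
  by_cases hx : ε • x ∈ Ω
  · rw [Set.piecewise_eq_of_mem _ _ _ (show x ∈ {x : E3 | ε • x ∈ Ω} from hx), penalizedPrimitive_of_mem hx]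
  · rw [Set.piecewise_eq_of_notMem _ _ _ (show x ∉ {x : E3 | ε • x ∈ Ω} from hx), penalizedPrimitive_of_notMem hx]

lemma hasGrowth_truncated (hf : IsNonlinearity s f) (ha : 0 < a) (hfa : f a = P.V₀ / K * a)
    (hVK : 0 ≤ P.V₀ / K) (q : ℝ) : HasGrowth (truncated f P.V₀ K a) (P.V₀ / K) q := fun t =>
  (hf.abs_truncated_le ha hfa hVK t).trans (mul_le_mul_of_nonneg_left
    (by linarith [Real.rpow_nonneg (abs_nonneg t) (q - 1)]) hVK)

lemma integrable_primitive_truncated (hs : 0 < s) (hs' : s < 1) (hf : IsNonlinearity s f)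
    (ha : 0 < a) (hfa : f a = P.V₀ / K * a) (hVK : 0 ≤ P.V₀ / K) (u : HSpace s P ε) :
    Integrable (fun x => ∫ τ in (0 : ℝ)..(u x), truncated f P.V₀ K a τ) := by
  obtain ⟨C, q, hC, hq, hq', -⟩ := hf.exists_hasGrowth
  exact integrable_primitive_comp hs hs' (hf.continuous_truncated hfa)
    (hasGrowth_truncated hf ha hfa hVK q) hVK hq hq' u

lemma integrable_primitive (hs : 0 < s) (hs' : s < 1) (hf : IsNonlinearity s f)
    (u : HSpace s P ε) : Integrable (fun x => ∫ τ in (0 : ℝ)..(u x), f τ) := by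
  obtain ⟨C, q, hC, hq, hq', hg⟩ := hf.exists_hasGrowth
  exact integrable_primitive_comp hs hs' hf.continuous hg hC hq hq' u

lemma integrable_penalizedPrimitive (hs : 0 < s) (hs' : s < 1) (hf : IsNonlinearity s f)
    (hΩ : IsOpen Ω) (ha : 0 < a) (hfa : f a = P.V₀ / K * a) (hVK : 0 ≤ P.V₀ / K)
    (u : HSpace s P ε) :
    Integrable (fun x : E3 => penalizedPrimitive f P.V₀ K a Ω (ε • x) (u x)) := by
  classical
  rw [penalizedPrimitive_comp_eq_piecewise]
  exact Integrable.piecewise (measurableSet_preimage_smul hΩ ε)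
    (u.integrable_primitive hs hs' hf).integrableOn
    (u.integrable_primitive_truncated hs hs' hf ha hfa hVK).integrableOn

lemma energy_eq (hs : 0 < s) (hs' : s < 1) (hf : IsNonlinearity s f)
    (hΩ : IsOpen Ω) (ha : 0 < a) (hfa : f a = P.V₀ / K * a) (hVK : 0 ≤ P.V₀ / K)
    (u : HSpace s P ε) :
    energy s P ε M f K a Ω u = 1 / 2 * (∫ τ in (0 : ℝ)..(‖u‖ ^ 2), M τ) -
      ((∫ x in {x : E3 | ε • x ∈ Ω}, ∫ τ in (0 : ℝ)..(u x), f τ) +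
        ∫ x in {x : E3 | ε • x ∈ Ω}ᶜ, ∫ τ in (0 : ℝ)..(u x), truncated f P.V₀ K a τ) := by
  classical
  rw [energy, penalizedPrimitive_comp_eq_piecewise,
    integral_piecewise (measurableSet_preimage_smul hΩ ε)
      (u.integrable_primitive hs hs' hf).integrableOn
      (u.integrable_primitive_truncated hs hs' hf ha hfa hVK).integrableOn]

/-- The derivative of the energy. -/
lemma exists_hasFDerivAt_energy (hs : 0 < s) (hs' : s < 1) (hM : IsKirchhoff M m₀)
    (hf : IsNonlinearity s f) (hΩ : IsOpen Ω) (ha : 0 < a) (hfa : f a = P.V₀ / K * a)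
    (hVK : 0 ≤ P.V₀ / K) :
    ∃ D : HSpace s P ε → (HSpace s P ε →L[ℝ] ℝ), Continuous D ∧
      (∀ u, HasFDerivAt (energy s P ε M f K a Ω) (D u) u) ∧
      ∀ u v, D u v = M (‖u‖ ^ 2) * inner ℝ u v -
        ((∫ x in {x : E3 | ε • x ∈ Ω}, f (u x) * v x) +
          ∫ x in {x : E3 | ε • x ∈ Ω}ᶜ, truncated f P.V₀ K a (u x) * v x) := by
  obtain ⟨C, q, hC, hq, hq', hg⟩ := hf.exists_hasGrowth
  obtain ⟨D₁, hc₁, hd₁, he₁⟩ := exists_hasFDerivAt_of_growth (P := P) (ε := ε) hs hs'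
    {x : E3 | ε • x ∈ Ω} hf.continuous hg hC hq hq'
  obtain ⟨D₂, hc₂, hd₂, he₂⟩ := exists_hasFDerivAt_of_growth (P := P) (ε := ε) hs hs'
    {x : E3 | ε • x ∈ Ω}ᶜ (hf.continuous_truncated hfa) (hasGrowth_truncated hf ha hfa hVK q)
    hVK hq hq'
  -- The maximum is idle at ‖u‖² ≥ 0; it is there so that the continuous extension of M can be
  -- differentiated and composed.
  refine ⟨fun u => M (max (‖u‖ ^ 2) 0) • innerSL ℝ u - (D₁ u + D₂ u), ?_, fun u => ?_,
    fun u v => ?_⟩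
  · exact ((hM.continuous_extend.comp (continuous_norm.pow 2)).smul (innerSL ℝ).continuous).sub
      (hc₁.add hc₂)
  · have hK : HasFDerivAt (fun u : HSpace s P ε =>
        1 / 2 * ∫ τ in (0 : ℝ)..(‖u‖ ^ 2), M (max τ 0))
        (M (max (‖u‖ ^ 2) 0) • innerSL ℝ u) u := by
      have h := ((hasDerivAt_primitive hM.continuous_extend (‖u‖ ^ 2)).comp_hasFDerivAt u
        (hasStrictFDerivAt_norm_sq u).hasFDerivAt).const_mul (1 / 2)
      refine h.congr_fderiv ?_
      ext v
      simp
      ring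
    refine (hK.sub ((hd₁ u).add (hd₂ u))).congr_of_eventuallyEq (Eventually.of_forall fun w => ?_)
    rw [energy_eq hs hs' hf hΩ ha hfa hVK, ← IsKirchhoff.integral_extend M (sq_nonneg ‖w‖)]
    rfl
  · simp only [sub_apply, add_apply,
      smul_apply, innerSL_apply_apply, smul_eq_mul, he₁, he₂,
      max_eq_left (sq_nonneg ‖u‖)]

/-- Coercivity of `J - J'/4`. -/
lemma le_energy_sub_quarter_fderiv (hs : 0 < s) (hs' : s < 1) (hM : IsKirchhoff M m₀)
    (hf : IsNonlinearity s f) (hΩ : IsOpen Ω) (hK : 0 < K) (ha : 0 < a)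
    (hfa : f a = P.V₀ / K * a) (u : HSpace s P ε) {d : ℝ}
    (hd : d = M (‖u‖ ^ 2) * inner ℝ u u -
        ((∫ x in {x : E3 | ε • x ∈ Ω}, f (u x) * u x) +
          ∫ x in {x : E3 | ε • x ∈ Ω}ᶜ, truncated f P.V₀ K a (u x) * u x)) :
    1 / 4 * (m₀ - 1 / K) * ‖u‖ ^ 2 ≤ energy s P ε M f K a Ω u - 1 / 4 * d := by
  have hVK : 0 ≤ P.V₀ / K := div_nonneg P.V₀_pos.le hK.le
  obtain ⟨C, q, hC, hq, hq', hg⟩ := hf.exists_hasGrowth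
  set S := {x : E3 | ε • x ∈ Ω}
  rw [energy_eq hs hs' hf hΩ ha hfa hVK, hd, real_inner_self_eq_norm_sq]
  -- The trapezoid bound cancels ¼M(‖u‖²)‖u‖² exactly and leaves ¼m₀‖u‖², so no upper bound on M is
  -- needed.
  have h1 := hM.le_integral (sq_nonneg ‖u‖)
  have i1 : Integrable fun x => f (u x) * u x :=
    integrable_comp_mul hs hs' hf.continuous hg hC hq hq' u u
  have i2 : Integrable fun x => truncated f P.V₀ K a (u x) * u x :=
    integrable_comp_mul hs hs' (hf.continuous_truncated hfa)
      (hasGrowth_truncated hf ha hfa hVK q) hVK hq hq' u u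
  have j1 := u.integrable_primitive hs hs' hf
  have j2 := u.integrable_primitive_truncated hs hs' hf ha hfa hVK
  have h2 : 0 ≤ (∫ x in S, f (u x) * u x) - 4 * ∫ x in S, ∫ τ in (0 : ℝ)..(u x), f τ := by
    rw [← integral_const_mul, ← integral_sub i1.integrableOn (j1.const_mul 4).integrableOn]
    exact integral_nonneg fun x => hf.four_mul_primitive_le (u x)
  have h3 : -(P.V₀ / K * ∫ x in Sᶜ, u x ^ 2) ≤ (∫ x in Sᶜ, truncated f P.V₀ K a (u x) * u x) -
      4 * ∫ x in Sᶜ, ∫ τ in (0 : ℝ)..(u x), truncated f P.V₀ K a τ := by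
    rw [← integral_const_mul, ← integral_const_mul, ← integral_neg,
      ← integral_sub i2.integrableOn (j2.const_mul 4).integrableOn]
    exact integral_mono (u.integrable_sq.const_mul _).neg.integrableOn
      (i2.sub (j2.const_mul 4)).integrableOn
      fun x => hf.truncated_four_mul_primitive_le ha hfa hVK (u x)
  have h4 : P.V₀ / K * ∫ x in Sᶜ, u x ^ 2 ≤ 1 / K * ‖u‖ ^ 2 := by
    have h5 := mul_le_mul_of_nonneg_left (u.setIntegral_sq_le Sᶜ) P.V₀_pos.le
    rw [div_mul_eq_mul_div, one_div_mul_eq_div]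
    exact div_le_div_of_nonneg_right (h5.trans u.integral_sq_le) hK.le
  nlinarith

/-- Coercivity of J - ¼J' bounds c‖u_n‖² by a constant plus a multiple of ‖u_n‖, where c = ¼(m₀ -
1/K) > 0. -/
lemma bounded_of_isPSSequence (hs : 0 < s) (hs' : s < 1) (hM : IsKirchhoff M m₀)
    (hf : IsNonlinearity s f) (hΩ : IsOpen Ω) (hK : 2 / m₀ < K) (ha : 0 < a)
    (hfa : f a = P.V₀ / K * a) {d : ℝ} {u : ℕ → HSpace s P ε}
    (hu : IsPSSequence (energy s P ε M f K a Ω) d u) : ∃ R, ∀ n, ‖u n‖ ≤ R := by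
  have hm := hM.m₀_pos
  have hK0 : 0 < K := (by positivity : 0 < 2 / m₀).trans hK
  have hVK : 0 ≤ P.V₀ / K := div_nonneg P.V₀_pos.le hK0.le
  obtain ⟨D, -, hD, hDe⟩ := exists_hasFDerivAt_energy (P := P) (ε := ε) (Ω := Ω) hs hs' hM hf hΩ
    ha hfa hVK
  have hc : 0 < 1 / 4 * (m₀ - 1 / K) := by
    rw [div_lt_iff₀ hm] at hK
    have : 1 / K < m₀ := by rw [div_lt_iff₀ hK0]; linarith
    linarith
  set c := 1 / 4 * (m₀ - 1 / K)
  obtain ⟨A, hA⟩ := hu.1.norm.bddAbove_range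
  obtain ⟨B, hB⟩ := hu.2.norm.bddAbove_range
  -- Above norm 1 the constant A is at most A‖u_n‖, and one factor of the norm can be divided out.
  refine ⟨max 1 ((A + B) / c), fun n => ?_⟩
  have hAn : |energy s P ε M f K a Ω (u n)| ≤ A := hA (mem_range_self n)
  have hBn : ‖D (u n)‖ ≤ B := by
    rw [← (hD (u n)).fderiv]; exact hB (mem_range_self n)
  have h := le_energy_sub_quarter_fderiv hs hs' hM hf hΩ hK0 ha hfa (u n) (hDe (u n) (u n))
  have h2 : |D (u n) (u n)| ≤ B * ‖u n‖ :=
    ((D (u n)).le_opNorm (u n)).trans (mul_le_mul_of_nonneg_right hBn (norm_nonneg _))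
  rcases le_or_gt (‖u n‖) 1 with h1 | h1
  · exact h1.trans (le_max_left _ _)
  · refine le_trans ?_ (le_max_right _ _)
    rw [le_div_iff₀ hc]
    refine le_of_mul_le_mul_right ?_ (zero_lt_one.trans h1)
    have hA0 : 0 ≤ A := (abs_nonneg _).trans hAn
    have hB0 : 0 ≤ B := (norm_nonneg (D (u n))).trans hBn
    have h3 := (abs_le.1 hAn).2
    have h4 := (abs_le.1 h2).1
    have h5 : A * 1 ≤ A * ‖u n‖ := mul_le_mul_of_nonneg_left h1.le hA0
    have h6 := mul_nonneg hB0 (norm_nonneg (u n))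
    change c * ‖u n‖ ^ 2 ≤ _ at h
    calc ‖u n‖ * c * ‖u n‖ = c * ‖u n‖ ^ 2 := by ring
      _ ≤ (A + B) * ‖u n‖ := by linarith

lemma pointwise_truncated_mul_le (hf : IsNonlinearity s f) (ha : 0 < a)
    (hfa : f a = P.V₀ / K * a) (hVK : 0 ≤ P.V₀ / K) (t w : ℝ) :
    truncated f P.V₀ K a (t + w) * w ≤ P.V₀ / K * (w ^ 2 + |t| * |w|) := by
  have h1 := hf.abs_truncated_le ha hfa hVK (t + w)
  have h2 := mul_le_mul_of_nonneg_right (h1.trans (mul_le_mul_of_nonneg_left (abs_add_le t w) hVK))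
    (abs_nonneg w)
  have h3 := le_abs_self (truncated f P.V₀ K a (t + w) * w)
  rw [abs_mul] at h3
  have h4 := sq_abs w
  nlinarith

/-- Testing the derivative at u with w = u - v turns the Kirchhoff term into M(‖u‖²)(‖w‖² + (w,v)).
On the complement of S, writing u = v + w bounds the truncated term by (V₀/K)∫(w² + |v||w|); the
part with w² is at most ‖w‖²/K and is absorbed on the left. Everything remaining on the right
vanishes along a bounded Palais–Smale sequence when v is its weak limit and S is bounded. -/
lemma norm_sq_mul_le_of_weak_remainder (hs : 0 < s) (hs' : s < 1) (hM : IsKirchhoff M m₀)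
    (hf : IsNonlinearity s f) (hK : 0 < K) (ha : 0 < a)
    (hfa : f a = P.V₀ / K * a) (u v : HSpace s P ε) (S : Set E3) {d : ℝ}
    (hd : d = M (‖u‖ ^ 2) * inner ℝ u (u - v) - ((∫ x in S, f (u x) * (u - v) x) +
          ∫ x in Sᶜ, truncated f P.V₀ K a (u x) * (u - v) x)) :
    (m₀ - 1 / K) * ‖u - v‖ ^ 2 ≤ d - M (‖u‖ ^ 2) * inner ℝ (u - v) v +
      (∫ x in S, f (u x) * (u - v) x) + P.V₀ / K * ∫ x, |v x| * |(u - v) x| := by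
  have hVK : 0 ≤ P.V₀ / K := div_nonneg P.V₀_pos.le hK.le
  obtain ⟨C, q, hC, hq, hq', hg⟩ := hf.exists_hasGrowth
  set w := u - v with hw
  have hi : inner ℝ u w = ‖w‖ ^ 2 + inner ℝ w v := by
    rw [← real_inner_self_eq_norm_sq, real_inner_comm v w, ← inner_add_left, hw, sub_add_cancel]
  have i2 : Integrable fun x => truncated f P.V₀ K a (u x) * w x :=
    integrable_comp_mul hs hs' (hf.continuous_truncated hfa)
      (hasGrowth_truncated hf ha hfa hVK q) hVK hq hq' u w
  have j : Integrable fun x => P.V₀ / K * (w x ^ 2 + |v x| * |w x|) :=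
    (w.integrable_sq.add (integrable_mul v w)).const_mul _
  have h1 : ∫ x in Sᶜ, truncated f P.V₀ K a (u x) * w x ≤
      P.V₀ / K * ((∫ x, w x ^ 2) + ∫ x, |v x| * |w x|) := by
    rw [← integral_add w.integrable_sq (integrable_mul v w), ← integral_const_mul]
    refine le_trans (integral_mono_ae i2.integrableOn j.integrableOn (ae_restrict_of_ae ?_))
      (setIntegral_le_integral j (Eventually.of_forall fun x => mul_nonneg hVK (by positivity)))
    filter_upwards [coe_sub u v] with x hx
    have e : u x = v x + w x := by rw [hw, hx, Pi.sub_apply]; ring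
    rw [e]
    exact pointwise_truncated_mul_le hf ha hfa hVK _ _
  have h2 : P.V₀ / K * ∫ x, w x ^ 2 ≤ 1 / K * ‖w‖ ^ 2 := by
    rw [div_mul_eq_mul_div, one_div_mul_eq_div]
    exact div_le_div_of_nonneg_right w.integral_sq_le hK.le
  have h3 := mul_le_mul_of_nonneg_right (hM.lower (‖u‖ ^ 2) (sq_nonneg _)) (sq_nonneg ‖w‖)
  rw [hd, hi]
  linarith

/-- The penalized energy satisfies the Palais–Smale condition. -/
theorem psCondition_energy (hs : 0 < s) (hs' : s < 1) (hM : IsKirchhoff M m₀)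
    (hf : IsNonlinearity s f) (hΩ : IsOpen Ω) (hΩb : Bornology.IsBounded Ω) (hε : 0 < ε)
    (hK : 2 / m₀ < K) (ha : 0 < a) (hfa : f a = P.V₀ / K * a) (d : ℝ) :
    PSCondition (energy s P ε M f K a Ω) d := by
  intro u hu
  obtain ⟨R, hR⟩ := bounded_of_isPSSequence hs hs' hM hf hΩ hK ha hfa hu
  have hm := hM.m₀_pos
  have hK0 : 0 < K := (by positivity : 0 < 2 / m₀).trans hK
  have hVK : 0 ≤ P.V₀ / K := div_nonneg P.V₀_pos.le hK0.le
  have hc : 0 < m₀ - 1 / K := by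
    rw [div_lt_iff₀ hm] at hK
    have : 1 / K < m₀ := by rw [div_lt_iff₀ hK0]; linarith
    linarith
  obtain ⟨D, -, hD, hDe⟩ := exists_hasFDerivAt_energy (P := P) (ε := ε) (Ω := Ω) hs hs' hM hf hΩ
    ha hfa hVK
  obtain ⟨C, q, hC, hq, hq', hg⟩ := hf.exists_hasGrowth
  have hSb : Bornology.IsBounded {x : E3 | ε • x ∈ Ω} := by
    obtain ⟨ρ, hρ⟩ := hΩb.exists_norm_le
    refine (Metric.isBounded_closedBall (x := (0 : E3)) (r := ρ / ε)).subset fun x hx => ?_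
    have := hρ _ hx
    rw [norm_smul, Real.norm_of_nonneg hε.le] at this
    rw [mem_closedBall_zero_iff, le_div_iff₀ hε, mul_comm]
    exact this
  obtain ⟨v, φ, hφ, hweak⟩ := exists_weakly_convergent_subseq u R hR
  refine ⟨v, φ, hφ, ?_⟩
  set w : ℕ → HSpace s P ε := fun n => u (φ n) - v with hw
  have hwweak : ∀ y, Tendsto (fun n => inner ℝ (w n) y) atTop (𝓝 0) := fun y => by
    have h := (hweak y).sub_const (inner ℝ v y)
    rw [sub_self] at h
    exact h.congr fun n => (inner_sub_left _ _ _).symm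
  set R' := R + ‖v‖
  have hwR : ∀ n, ‖w n‖ ≤ R' := fun n => (norm_sub_le _ _).trans (by linarith [hR (φ n)])
  have huR : ∀ n, ‖u (φ n)‖ ≤ R' := fun n => (hR _).trans (by linarith [norm_nonneg v])
  have hDw : Tendsto (fun n => D (u (φ n)) (w n)) atTop (𝓝 0) := by
    have h := (hu.2.comp hφ.tendsto_atTop).norm.mul_const R'
    rw [norm_zero, zero_mul] at h
    refine squeeze_zero_norm (fun n => ?_) h
    rw [Function.comp_apply, (hD _).fderiv]
    exact (D (u (φ n))).le_of_opNorm_le_of_le le_rfl (hwR n)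
  -- Monotonicity of M bounds M(‖u_n‖²) by M(R'²), so convergence of the norms ‖u_n‖ is not
  -- required.
  have hMi : Tendsto (fun n => M (‖u (φ n)‖ ^ 2) * inner ℝ (w n) v) atTop (𝓝 0) := by
    have h := (hwweak v).norm.const_mul (M (R' ^ 2))
    rw [norm_zero, mul_zero] at h
    refine squeeze_zero_norm (fun n => ?_) h
    have h0 := hm.le.trans (hM.lower (‖u (φ n)‖ ^ 2) (sq_nonneg _))
    rw [norm_mul, Real.norm_of_nonneg h0]
    exact mul_le_mul_of_nonneg_right (hM.mono (mem_Ici.2 (sq_nonneg _)) (mem_Ici.2 (sq_nonneg _))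
      (pow_le_pow_left₀ (norm_nonneg _) (huR n) 2)) (norm_nonneg _)
  have hS := tendsto_setIntegral_comp_mul_of_weak hs hs' hg hC hq hq' huR hwR hwweak
    hSb
  have hv := (tendsto_integral_mul_of_weak hs v hwR hwweak).const_mul (P.V₀ / K)
  have hsum := ((hDw.sub hMi).add hS).add hv
  simp only [sub_zero, add_zero, mul_zero] at hsum
  have hfin : Tendsto (fun n => (m₀ - 1 / K) * ‖w n‖ ^ 2) atTop (𝓝 0) :=
    squeeze_zero (fun n => by positivity) (fun n =>
      norm_sq_mul_le_of_weak_remainder hs hs' hM hf hK0 ha hfa (u (φ n)) v _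
        (hDe (u (φ n)) (w n))) hsum
  have h2 : Tendsto (fun n => ‖w n‖ ^ 2) atTop (𝓝 0) := by
    have := hfin.const_mul (m₀ - 1 / K)⁻¹
    simpa only [inv_mul_cancel_left₀ hc.ne', mul_zero] using this
  refine tendsto_iff_norm_sub_tendsto_zero.2 ?_
  have h3 := h2.sqrt
  simpa only [Real.sqrt_sq (norm_nonneg _), Real.sqrt_zero] using h3

end HSpace

end FracKirchhoff

open FracKirchhoff in
theorem proposition3p3
    (s : ℝ) (hs : 3 / 4 < s) (hs' : s < 1)
    (M : ℝ → ℝ) (m₀ : ℝ) (hM : IsKirchhoff M m₀)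
    (P : Potential) (δ : ℝ) (hδ : 0 < δ) (Ω : Set E3) (hΩ : IsWellDomain P δ Ω)
    (f : ℝ → ℝ) (hf : IsNonlinearity s f)
    (K : ℝ) (hK : 2 / m₀ < K) (a : ℝ) (ha : 0 < a) (hfa : f a = P.V₀ / K * a)
    (ε : ℝ) (hε : 0 < ε) :
    -- the functional is well defined and continuously differentiable on `H_ε`
    (∀ u : HSpace s P ε, MeasureTheory.Integrable
      (fun x : E3 => penalizedPrimitive f P.V₀ K a Ω (ε • x) (u x))) ∧
    ContDiff ℝ 1 (energy s P ε M f K a Ω) ∧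
    -- and it satisfies the Palais–Smale condition at every level
    ∀ d : ℝ, PSCondition (energy s P ε M f K a Ω) d := by
  have hs0 : 0 < s := by linarith
  have hK0 : 0 < K := (div_pos two_pos hM.m₀_pos).trans hK
  have hVK : 0 ≤ P.V₀ / K := div_nonneg P.V₀_pos.le hK0.le
  refine ⟨fun u => HSpace.integrable_penalizedPrimitive hs0 hs' hf hΩ.isOpen ha hfa hVK u, ?_,
    fun d => HSpace.psCondition_energy hs0 hs' hM hf hΩ.isOpen hΩ.isBounded hε hK ha hfa d⟩
  obtain ⟨D, hDc, hD, -⟩ := HSpace.exists_hasFDerivAt_energy (P := P) (ε := ε) (Ω := Ω) hs0 hs'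
    hM hf hΩ.isOpen ha hfa hVK
  rw [contDiff_one_iff_fderiv]
  refine ⟨fun u => (hD u).differentiableAt, ?_⟩
  rw [show fderiv ℝ (energy s P ε M f K a Ω) = D from funext fun u => (hD u).fderiv]
  exact hDc
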